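/- Let $-\infty<\omega_*<\omega^*<+\infty$ and $T>0$, let $(e_1,e_2,e_3)$ be the canonical basis of $\mathbb R^3$, $\wedge$ the vector product, and identify the elements of $H^1(\omega_*,\omega^*)$ with their continuous representatives on $[\omega_*,\omega^*]$; $\|f\|_{H^1}^2=\int_{\omega_*}^{\omega^*}(\|f\|^2+\|f'\|^2)\,d\omega$, with the Euclidean norm on $\mathbb R^3$ and the associated operator norm on $3\times 3$ matrices. Put $$\sigma(t)=\int_0^t(-1)^{\lfloor s/T\rfloor}\,ds,\qquad S=\begin{pmatrix}0&1&0\\-1&0&0\\0&0&0\end{pmatrix},\qquad F(t,\omega)=R(\omega)\exp(\sigma(t)\,\omega S).$$ For $R\in H^1((\omega_*,\omega^*),SO_3(\mathbb R))$ the closed-loop system is $$\frac{\partial N}{\partial t}(t,\omega)=\sum_{i=1}^2 u_i(t,N(t))\,[F(t,\omega)e_i]\wedge N(t,\omega),\qquad u_i(t,N)=-H_i[t,N],$$ $$H_i[t,N]=\int_{\omega_*}^{\omega^*}\Big(\Big\langle \frac{dN}{d\omega},\Big(\frac{\partial F}{\partial\omega}(t,\omega)e_i\Big)\wedge N(\omega)\Big\rangle+\big\langle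 e_3,(F(t,\omega)e_i)\wedge N(\omega)\big\rangle\Big)d\omega ,$$ its solutions being the functions $N\in C^1([0,\infty),H^1((\omega_*,\omega^*),\mathbb R^3))$ that satisfy it for all $t\ge 0$. The Lyapunov functional is $$\mathcal L(N)=\int_{\omega_*}^{\omega^*}\Big(\tfrac12\Big\|\frac{\partial N}{\partial\omega}\Big\|^2+1+\langle N,e_3\rangle\Big)d\omega .$$ Let $M_f\in H^1((\omega_*,\omega^*),\mathbb S^2)$ satisfy $\langle M_f(\omega),e_3\rangle\neq 0$ for all $\omega\in[\omega_*,\omega^*]$, and let $C\in\mathbb R$. Then there is $\delta>0$ such that, for every $R\in H^1((\omega_*,\omega^*),SO_3(\mathbb R))$ with $R(\omega)M_f(\omega)=-e_3$ on $[\omega_*,\omega^*]$ and $\|R\|_{H^1}\le C\|M_f\|_{H^1}$, for every $N_0\in H^1((\omega_*,\omega^*),\mathbb S^2)$ with $\|N_0+e_3\|_{H^1}<\delta$ and for every solution $N$ of the closed-loop system with $N(0)=N_0$, the map $t\mapsto\mathcal L[N(t)]$ is constant on $[0,+\infty)$ if and only if $N_0=-e_3$. -/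

import Mathlib

open Set Filter Topology MeasureTheory
open scoped Matrix

namespace BlochEnsemble

noncomputable section

/-! ### The Sobolev space `H¹` of a bounded interval `(a, b)`

An element of `H¹((a, b), E)` is identified with its continuous representative on `[a, b]`; the
values of the function outside `[a, b]` play no role. -/

/-- `g` is a weak derivative of `f` on the open interval `(a, b)`. -/
def HasWeakDeriv {E : Type*} [NormedAddCommGroup E] [NormedSpace ℝ E]
    (a b : ℝ) (f g : ℝ → E) : Prop :=
  ∀ φ : ℝ → ℝ, ContDiff ℝ (⊤ : ℕ∞) φ → HasCompactSupport φ → tsupport φ ⊆ Ioo a b →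
    ∫ x in Ioo a b, deriv φ x • f x = -∫ x in Ioo a b, φ x • g x

/-- `f` is (the continuous representative of) a function of `H¹((a, b), E)`: it is continuous on
`[a, b]` and has a weak derivative in `L²(a, b)`. -/
def MemH1 {E : Type*} [NormedAddCommGroup E] [NormedSpace ℝ E]
    (a b : ℝ) (f : ℝ → E) : Prop :=
  ContinuousOn f (Icc a b) ∧
    ∃ g : ℝ → E, MemLp g 2 (volume.restrict (Ioo a b)) ∧ HasWeakDeriv a b f g

open Classical in
/-- The weak derivative of a function of `H¹((a, b), E)` (unique up to a null set of `(a, b)`). -/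
def weakDeriv {E : Type*} [NormedAddCommGroup E] [NormedSpace ℝ E]
    (a b : ℝ) (f : ℝ → E) : ℝ → E :=
  if h : ∃ g : ℝ → E, MemLp g 2 (volume.restrict (Ioo a b)) ∧ HasWeakDeriv a b f g
  then h.choose else 0

/-- The norm `(∫ ‖f‖² + ‖f'‖²)^(1/2)` of `H¹((a, b), E)`. -/
def h1norm {E : Type*} [NormedAddCommGroup E] [NormedSpace ℝ E]
    (a b : ℝ) (f : ℝ → E) : ℝ :=
  Real.sqrt ((∫ x in Ioo a b, ‖f x‖ ^ 2) + ∫ x in Ioo a b, ‖weakDeriv a b f x‖ ^ 2)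

/-- `N` belongs to `C¹([0, ∞), H¹((a, b), E))` and `V` is its derivative in time: both take values
in `H¹`, the difference quotients of `N` converge to `V` in the `H¹` norm (one-sided at `t = 0`),
and `V` is continuous for the `H¹` norm. -/
structure IsC1H1 {E : Type*} [NormedAddCommGroup E] [NormedSpace ℝ E]
    (a b : ℝ) (N V : ℝ → ℝ → E) : Prop where
  mem : ∀ t, 0 ≤ t → MemH1 a b (N t)
  mem_deriv : ∀ t, 0 ≤ t → MemH1 a b (V t)
  hasDeriv : ∀ t, 0 ≤ t →
    Tendsto (fun s => h1norm a b ((s - t)⁻¹ • (N s - N t) - V t)) (𝓝[Ici 0 \ {t}] t) (𝓝 0)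
  cont : ∀ t, 0 ≤ t → Tendsto (fun s => h1norm a b (V s - V t)) (𝓝[Ici 0] t) (𝓝 0)

/-! ### The closed-loop system -/

/-- Euclidean space `ℝ³`. -/
abbrev E3 : Type := EuclideanSpace ℝ (Fin 3)

/-- The canonical basis of `ℝ³`: `e 0`, `e 1`, `e 2` are `e₁`, `e₂`, `e₃`. -/
def e (i : Fin 3) : E3 := EuclideanSpace.single i 1

/-- The vector product of `ℝ³`. -/
def cross (x y : E3) : E3 := WithLp.toLp 2 (x.ofLp ⨯₃ y.ofLp)

/-- The linear operator of the Euclidean space `ℝ³` given by a matrix. -/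
def toOp (A : Matrix (Fin 3) (Fin 3) ℝ) : E3 →L[ℝ] E3 := Matrix.toEuclideanCLM (𝕜 := ℝ) A

/-- The sign `(-1) ^ ⌊t / T⌋`. -/
def eps (T t : ℝ) : ℝ := (-1) ^ ⌊t / T⌋

/-- `σ(t) = ∫₀ᵗ ε(s) ds`. -/
def sigma (T t : ℝ) : ℝ := ∫ s in (0 : ℝ)..t, eps T s

/-- The matrix `S`. -/
def S : Matrix (Fin 3) (Fin 3) ℝ := !![0, 1, 0; -1, 0, 0; 0, 0, 0]

/-- `F(t, ω) = R(ω) exp(σ(t) ω S)`. -/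
def F (T : ℝ) (R : ℝ → Matrix (Fin 3) (Fin 3) ℝ) (t ω : ℝ) : Matrix (Fin 3) (Fin 3) ℝ :=
  R ω * NormedSpace.exp ((sigma T t * ω) • S)

/-- The vector field `ω ↦ F(t, ω) eᵢ`. -/
def Fe (T : ℝ) (R : ℝ → Matrix (Fin 3) (Fin 3) ℝ) (i : Fin 3) (t ω : ℝ) : E3 :=
  toOp (F T R t ω) (e i)

/-- The Lyapunov functional `∫ (‖N'‖² / 2 + 1 + ⟨N, e₃⟩) dω`. -/
def lyapunov (a b : ℝ) (N : ℝ → E3) : ℝ :=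
  ∫ ω in Ioo a b, (1 / 2 * ‖weakDeriv a b N ω‖ ^ 2 + 1 + inner ℝ (N ω) (e 2))

/-- `Hᵢ[t, N] = ∫ (⟨N', (∂F/∂ω eᵢ) ∧ N⟩ + ⟨e₃, (F eᵢ) ∧ N⟩) dω`. -/
def H (a b T : ℝ) (R : ℝ → Matrix (Fin 3) (Fin 3) ℝ) (i : Fin 3) (t : ℝ) (N : ℝ → E3) : ℝ :=
  ∫ ω in Ioo a b,
    (inner ℝ (weakDeriv a b N ω) (cross (weakDeriv a b (Fe T R i t) ω) (N ω)) +
      inner ℝ (e 2) (cross (Fe T R i t ω) (N ω)))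

/-- The feedback law `uᵢ(t, N) = -Hᵢ[t, N]`. -/
def u (a b T : ℝ) (R : ℝ → Matrix (Fin 3) (Fin 3) ℝ) (i : Fin 3) (t : ℝ) (N : ℝ → E3) : ℝ :=
  -H a b T R i t N

/-- `N ∈ C¹([0, ∞), H¹((a, b), ℝ³))` solves the closed-loop system
`∂N/∂t = ∑ᵢ uᵢ(t, N(t)) (F(t, ω) eᵢ) ∧ N`, `i = 1, 2`, with `N(0) = N₀`. -/
def IsSolution (a b T : ℝ) (R : ℝ → Matrix (Fin 3) (Fin 3) ℝ) (N₀ : ℝ → E3)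
    (N : ℝ → ℝ → E3) : Prop :=
  EqOn (N 0) N₀ (Icc a b) ∧
    ∃ V : ℝ → ℝ → E3, IsC1H1 a b N V ∧
      ∀ t, 0 ≤ t → ∀ ω ∈ Icc a b,
        V t ω = u a b T R 0 t (N t) • cross (Fe T R 0 t ω) (N t ω) +
          u a b T R 1 t (N t) • cross (Fe T R 1 t ω) (N t ω)

/-- `f ∈ H¹((a, b), 𝕊²)`. -/
def MemH1Sphere (a b : ℝ) (f : ℝ → E3) : Prop :=
  MemH1 a b f ∧ ∀ ω ∈ Icc a b, ‖f ω‖ = 1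

/-- `R ∈ H¹((a, b), SO₃(ℝ))`. -/
def MemH1SO3 (a b : ℝ) (R : ℝ → Matrix (Fin 3) (Fin 3) ℝ) : Prop :=
  MemH1 a b (fun ω => toOp (R ω)) ∧
    ∀ ω ∈ Icc a b, R ω ∈ Matrix.specialOrthogonalGroup (Fin 3) ℝ

end

end BlochEnsemble

open BlochEnsemble

/-!
Along a solution `N`, the derivative of `ℒ(N(t))` is `u₁ H₁ + u₂ H₂ = -(H₁² + H₂²)`. If
`N₀ = -e₃`, then `ℒ` starts from its minimum `0` on the sphere-valued functions, so it stays there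
(the flow preserves `‖N(t, ω)‖` pointwise). Conversely, if `ℒ` is constant, both feedbacks vanish,
the solution stays at `N₀`, and `H₁[t, N₀] = H₂[t, N₀] = 0` for all `t ≥ 0`.

To exploit this, write `n = N₀`, `J = n ∧ n'`, `K = n ∧ e₃` and `Xⱼ = R eⱼ`. As
`F (e₁ + i e₂) = exp(i σ ω) (X₁ + i X₂)` and `σ(t) = t` on `[0, T)`, the two conditions say that
`∫ exp(i s ω) (q + i s p) dω = 0` for `s ∈ [0, T)`, where `p = ⟨X₁ + i X₂, J⟩` and
`q = ⟨X₁' + i X₂', J⟩ + ⟨X₁ + i X₂, K⟩`. This is the Fourier transform of a compactly supported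
distribution, so it vanishes identically; hence `p` is a primitive of `q` vanishing at both
endpoints (`exists_isPrimitive_of_integral_cexp_mul_eq_zero`). In other words the equation
`J' = K`, with `J = 0` at the endpoints, holds in the weak sense when tested against
`φ R e₁` and `φ R e₂` for `φ` in `H¹` (`integral_test_column_eq_zero`). Tested against `φ n` it
holds trivially, since `J` and `K` are orthogonal to `n` and `J` is orthogonal to `n'`.

The relation `R M_f = -e₃` gives `⟨e₃, R e₃⟩ = -⟨M_f, e₃⟩ ≠ 0`, so `(R e₁, R e₂, n)` is a frame when
`n` is uniformly close to `-e₃`; closeness is measured by the Sobolev embedding and does not depend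
on `R` (`exists_pos_forall_inner_ne_zero`). Therefore the test function `K` itself is allowed
(`exists_frame_decomposition`), and it yields `∫ (-⟨n, e₃⟩ ‖n'‖² + ‖n ∧ e₃‖²) dω = 0`. Both terms are
nonnegative in the lower hemisphere, so `n ∧ e₃ = 0` and `n = -e₃`
(`eq_neg_e_two_of_feedback_eq_zero`).

Functions of `H¹` are handled as primitives of square integrable functions (`HasH1Deriv`), which
rests on the du Bois-Reymond lemma and on absolutely continuous functions.
-/

namespace BlochEnsemble

noncomputable section

/-! ### Primitives of integrable functions -/

variable {E G W : Type*} [NormedAddCommGroup E] [NormedSpace ℝ E] [NormedAddCommGroup G]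
  [NormedSpace ℝ G] [NormedAddCommGroup W] [NormedSpace ℝ W] {a b : ℝ}

/-- `f` is on `[a, b]` a primitive of the integrable function `g`; equivalently, `f` is absolutely
continuous on `[a, b]` with derivative `g` almost everywhere. -/
structure IsPrimitive (a b : ℝ) (f g : ℝ → E) : Prop where
  integrable : IntegrableOn g (Ioo a b)
  eq_add_integral : ∀ x ∈ Icc a b, f x = f a + ∫ s in a..x, g s

theorem intervalIntegral_eq_setIntegral_Ioo (hab : a ≤ b) (g : ℝ → E) :
    ∫ x in a..b, g x = ∫ x in Ioo a b, g x := by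
  rw [intervalIntegral.integral_of_le hab, integral_Ioc_eq_integral_Ioo]

/-- Primitives of vector-valued integrable functions are absolutely continuous: their increments are
dominated by those of the primitive of the norm. -/
theorem absolutelyContinuousOnInterval_primitive {g : ℝ → E}
    (hg : IntervalIntegrable g volume a b) :
    AbsolutelyContinuousOnInterval (fun x => ∫ s in a..x, g s) a b := by
  have h := hg.norm.absolutelyContinuousOnInterval_intervalIntegral (c := a) left_mem_uIcc
  rw [absolutelyContinuousOnInterval_iff] at h ⊢
  intro ε hε
  obtain ⟨δ, hδ, H⟩ := h ε hε
  refine ⟨δ, hδ, fun I hI hI' => lt_of_le_of_lt (Finset.sum_le_sum fun i hi => ?_) (H I hI hI')⟩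
  have hmem : ∀ i ∈ Finset.range I.1, (I.2 i).1 ∈ uIcc a b ∧ (I.2 i).2 ∈ uIcc a b := hI.1
  obtain ⟨h1, h2⟩ := hmem i hi
  have i1 : IntervalIntegrable g volume a (I.2 i).1 := hg.mono_set (uIcc_subset_uIcc_left h1)
  have i2 : IntervalIntegrable g volume a (I.2 i).2 := hg.mono_set (uIcc_subset_uIcc_left h2)
  rw [dist_eq_norm, dist_eq_norm, intervalIntegral.integral_interval_sub_left i1 i2,
    intervalIntegral.integral_interval_sub_left i1.norm i2.norm]
  exact intervalIntegral.norm_integral_le_abs_integral_norm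

namespace AbsolutelyContinuousOnInterval

/-- A function whose increments are dominated by those of two absolutely continuous functions is
absolutely continuous. -/
theorem of_dist_le {X Y Z : Type*} [PseudoMetricSpace X] [PseudoMetricSpace Y]
    [PseudoMetricSpace Z] {f : ℝ → X} {g : ℝ → Y} {k : ℝ → Z} {C D : ℝ}
    (hf : AbsolutelyContinuousOnInterval f a b) (hg : AbsolutelyContinuousOnInterval g a b)
    (h : ∀ x ∈ uIcc a b, ∀ y ∈ uIcc a b,
      dist (k x) (k y) ≤ C * dist (f x) (f y) + D * dist (g x) (g y)) :
    AbsolutelyContinuousOnInterval k a b := by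
  unfold AbsolutelyContinuousOnInterval at hf hg ⊢
  refine squeeze_zero' (Eventually.of_forall fun I => Finset.sum_nonneg fun i _ => dist_nonneg) ?_
    (by simpa using (hf.const_mul C).add (hg.const_mul D))
  filter_upwards [mem_inf_of_right (mem_principal_self _)] with I hI
  have hmem : ∀ i ∈ Finset.range I.1, (I.2 i).1 ∈ uIcc a b ∧ (I.2 i).2 ∈ uIcc a b := hI.1
  rw [Finset.mul_sum, Finset.mul_sum, ← Finset.sum_add_distrib]
  exact Finset.sum_le_sum fun i hi => h _ (hmem i hi).1 _ (hmem i hi).2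

theorem bilinear {f : ℝ → E} {g : ℝ → G} (B : E →L[ℝ] G →L[ℝ] W)
    (hf : AbsolutelyContinuousOnInterval f a b) (hg : AbsolutelyContinuousOnInterval g a b) :
    AbsolutelyContinuousOnInterval (fun x => B (f x) (g x)) a b := by
  obtain ⟨C, hC⟩ := hf.exists_bound
  obtain ⟨D, hD⟩ := hg.exists_bound
  refine of_dist_le (C := ‖B‖ * D) (D := ‖B‖ * C) hf hg fun x hx y hy => ?_
  have e : B (f x) (g x) - B (f y) (g y) = B (f x - f y) (g x) + B (f y) (g x - g y) := by
    simp
  rw [dist_eq_norm, dist_eq_norm, dist_eq_norm, e]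
  refine (norm_add_le _ _).trans (add_le_add ?_ ?_)
  · calc ‖B (f x - f y) (g x)‖ ≤ ‖B‖ * ‖f x - f y‖ * ‖g x‖ := B.le_opNorm₂ _ _
      _ ≤ ‖B‖ * ‖f x - f y‖ * D := by gcongr; exact hD x hx
      _ = ‖B‖ * D * ‖f x - f y‖ := by ring
  · calc ‖B (f y) (g x - g y)‖ ≤ ‖B‖ * ‖f y‖ * ‖g x - g y‖ := B.le_opNorm₂ _ _
      _ ≤ ‖B‖ * C * ‖g x - g y‖ := by gcongr; exact hC y hy

theorem inv {f : ℝ → ℝ} (hf : AbsolutelyContinuousOnInterval f a b)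
    (h0 : ∀ x ∈ uIcc a b, f x ≠ 0) : AbsolutelyContinuousOnInterval (fun x => (f x)⁻¹) a b := by
  obtain ⟨C, hC⟩ := isCompact_uIcc.exists_bound_of_continuousOn (hf.continuousOn.inv₀ h0)
  refine of_dist_le (C := C * C) (D := 0) hf hf fun x hx y hy => ?_
  have e : (f x)⁻¹ - (f y)⁻¹ = -((f x)⁻¹ * (f y)⁻¹ * (f x - f y)) := by
    have := h0 x hx
    have := h0 y hy
    field_simp
    ring
  rw [dist_eq_norm, dist_eq_norm, e, norm_neg, norm_mul, norm_mul, zero_mul, add_zero]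
  have := norm_nonneg (f x)⁻¹
  gcongr
  · exact (norm_nonneg _).trans (hC x hx)
  · exact hC x hx
  · exact hC y hy

end AbsolutelyContinuousOnInterval

namespace IsPrimitive

section

variable {f f₁ f₂ g g₁ g₂ : ℝ → E}

theorem intervalIntegrable (h : IsPrimitive a b f g) (hab : a ≤ b) :
    IntervalIntegrable g volume a b :=
  (intervalIntegrable_iff_integrableOn_Ioo_of_le hab).2 h.integrable

theorem congr (h : IsPrimitive a b f₁ g₁) (hab : a ≤ b) (hf : EqOn f₁ f₂ (Icc a b))
    (hg : g₁ =ᵐ[volume.restrict (Ioo a b)] g₂) : IsPrimitive a b f₂ g₂ := by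
  refine ⟨h.integrable.congr hg, fun x hx => ?_⟩
  rw [← hf hx, ← hf (left_mem_Icc.2 hab), h.eq_add_integral x hx,
    intervalIntegral_eq_setIntegral_Ioo hx.1, intervalIntegral_eq_setIntegral_Ioo hx.1]
  congr 1
  exact integral_congr_ae (ae_restrict_of_ae_restrict_of_subset (Ioo_subset_Ioo_right hx.2) hg)

theorem absolutelyContinuous (h : IsPrimitive a b f g) (hab : a ≤ b) :
    AbsolutelyContinuousOnInterval f a b := by
  have h1 := absolutelyContinuousOnInterval_primitive (h.intervalIntegrable hab)
  refine AbsolutelyContinuousOnInterval.of_dist_le (C := 1) (D := 0) h1 h1 fun x hx y hy => ?_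
  rw [uIcc_of_le hab] at hx hy
  rw [h.eq_add_integral x hx, h.eq_add_integral y hy, dist_add_left]
  simp

theorem continuousOn (h : IsPrimitive a b f g) (hab : a ≤ b) : ContinuousOn f (Icc a b) := by
  simpa [uIcc_of_le hab] using (h.absolutelyContinuous hab).continuousOn

theorem integral_eq_sub (h : IsPrimitive a b f g) (hab : a ≤ b) :
    ∫ x in Ioo a b, g x = f b - f a := by
  rw [h.eq_add_integral b (right_mem_Icc.2 hab), intervalIntegral_eq_setIntegral_Ioo hab]
  abel

theorem ae_hasDerivAt [CompleteSpace E] (h : IsPrimitive a b f g) (hab : a ≤ b) :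
    ∀ᵐ x ∂volume.restrict (Ioo a b), HasDerivAt f (g x) x := by
  rw [ae_restrict_iff' measurableSet_Ioo]
  filter_upwards [(h.intervalIntegrable hab).ae_hasDerivAt_integral] with x hx hxI
  have h1 := hx (by rw [uIcc_of_le hab]; exact Ioo_subset_Icc_self hxI) a left_mem_uIcc
  refine (h1.const_add (f a)).congr_of_eventuallyEq ?_
  filter_upwards [Ioo_mem_nhds hxI.1 hxI.2] with y hy
  exact h.eq_add_integral y (Ioo_subset_Icc_self hy)

theorem ae_unique [CompleteSpace E] (h₁ : IsPrimitive a b f g₁) (h₂ : IsPrimitive a b f g₂)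
    (hab : a ≤ b) : g₁ =ᵐ[volume.restrict (Ioo a b)] g₂ := by
  filter_upwards [h₁.ae_hasDerivAt hab, h₂.ae_hasDerivAt hab] with x hx hy
  exact hx.unique hy

/-- Fundamental theorem of calculus for vector-valued absolutely continuous functions. -/
theorem of_absolutelyContinuous [CompleteSpace E] (hab : a ≤ b)
    (hf : AbsolutelyContinuousOnInterval f a b) (hg : IntegrableOn g (Ioo a b))
    (h : ∀ᵐ x ∂volume.restrict (Ioo a b), HasDerivAt f (g x) x) : IsPrimitive a b f g := by
  have hgi : IntervalIntegrable g volume a b :=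
    (intervalIntegrable_iff_integrableOn_Ioo_of_le hab).2 hg
  have hF : IsPrimitive a b (fun x => ∫ s in a..x, g s) g :=
    ⟨hg, fun x _ => by simp⟩
  obtain ⟨c, hc⟩ := (hf.sub (hF.absolutelyContinuous hab)).const_of_ae_hasDerivAt_zero (by
    have e1 : ∀ᵐ x : ℝ, x ≠ a := by simp [ae_iff, measure_singleton]
    have e2 : ∀ᵐ x : ℝ, x ≠ b := by simp [ae_iff, measure_singleton]
    have h3 := hF.ae_hasDerivAt hab
    rw [ae_restrict_iff' measurableSet_Ioo] at h h3
    filter_upwards [h, h3, e1, e2] with x h4 h5 h6 h7 hx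
    rw [uIcc_of_le hab] at hx
    have hxI : x ∈ Ioo a b := ⟨lt_of_le_of_ne hx.1 (Ne.symm h6), lt_of_le_of_ne hx.2 h7⟩
    simpa using (h4 hxI).sub (h5 hxI))
  refine ⟨hg, fun x hx => ?_⟩
  have h1 := hc x (by rwa [uIcc_of_le hab])
  have h2 := hc a left_mem_uIcc
  simp only [Pi.sub_apply, intervalIntegral.integral_same, sub_zero] at h1 h2
  rw [h2, ← h1]
  abel

theorem clm_comp [CompleteSpace E] [CompleteSpace G] (L : E →L[ℝ] G) (h : IsPrimitive a b f g)
    (hab : a ≤ b) : IsPrimitive a b (fun x => L (f x)) (fun x => L (g x)) := by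
  refine ⟨L.integrable_comp h.integrable, fun x hx => ?_⟩
  rw [h.eq_add_integral x hx, map_add, L.intervalIntegral_comp_comm]
  exact (h.intervalIntegrable hab).mono_set
    (by rw [uIcc_of_le hab, uIcc_of_le hx.1]; exact Icc_subset_Icc_right hx.2)

theorem const (c : E) : IsPrimitive a b (fun _ => c) (fun _ => 0) :=
  ⟨integrableOn_zero, fun x _ => by simp⟩

theorem add (h₁ : IsPrimitive a b f₁ g₁) (h₂ : IsPrimitive a b f₂ g₂) (hab : a ≤ b) :
    IsPrimitive a b (fun x => f₁ x + f₂ x) (fun x => g₁ x + g₂ x) := by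
  refine ⟨h₁.integrable.add h₂.integrable, fun x hx => ?_⟩
  have hs : uIcc a x ⊆ uIcc a b := by
    rw [uIcc_of_le hab, uIcc_of_le hx.1]; exact Icc_subset_Icc_right hx.2
  rw [intervalIntegral.integral_add ((h₁.intervalIntegrable hab).mono_set hs)
    ((h₂.intervalIntegrable hab).mono_set hs), h₁.eq_add_integral x hx, h₂.eq_add_integral x hx]
  abel

theorem const_smul (c : ℝ) (h : IsPrimitive a b f g) :
    IsPrimitive a b (fun x => c • f x) (fun x => c • g x) :=
  ⟨h.integrable.smul c, fun x hx => by
    rw [intervalIntegral.integral_smul, h.eq_add_integral x hx, smul_add]⟩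

theorem sub (h₁ : IsPrimitive a b f₁ g₁) (h₂ : IsPrimitive a b f₂ g₂) (hab : a ≤ b) :
    IsPrimitive a b (fun x => f₁ x - f₂ x) (fun x => g₁ x - g₂ x) := by
  simpa [sub_eq_add_neg] using h₁.add (h₂.const_smul (-1)) hab

end

theorem of_hasDerivAt [CompleteSpace E] {f g : ℝ → E}
    (h : ∀ x, HasDerivAt f (g x) x) (hg : Continuous g) : IsPrimitive a b f g := by
  refine ⟨hg.integrableOn_Icc.mono_set Ioo_subset_Icc_self, fun x hx => ?_⟩
  rw [intervalIntegral.integral_eq_sub_of_hasDerivAt (fun y _ => h y) (hg.intervalIntegrable _ _)]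
  abel

/-- Product rule for a continuous bilinear product. -/
theorem bilinear [CompleteSpace E] [CompleteSpace G] [CompleteSpace W] {f f' : ℝ → E}
    {g g' : ℝ → G} (B : E →L[ℝ] G →L[ℝ] W) (hf : IsPrimitive a b f f') (hg : IsPrimitive a b g g')
    (hab : a ≤ b) :
    IsPrimitive a b (fun x => B (f x) (g x)) (fun x => B (f' x) (g x) + B (f x) (g' x)) := by
  have cf := hf.continuousOn hab
  have cg := hg.continuousOn hab
  obtain ⟨C, hC⟩ := isCompact_Icc.exists_bound_of_continuousOn cf
  obtain ⟨D, hD⟩ := isCompact_Icc.exists_bound_of_continuousOn cg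
  have mf : AEStronglyMeasurable f (volume.restrict (Ioo a b)) :=
    (cf.mono Ioo_subset_Icc_self).aestronglyMeasurable measurableSet_Ioo
  have mg : AEStronglyMeasurable g (volume.restrict (Ioo a b)) :=
    (cg.mono Ioo_subset_Icc_self).aestronglyMeasurable measurableSet_Ioo
  refine of_absolutelyContinuous hab
    (AbsolutelyContinuousOnInterval.bilinear B (hf.absolutelyContinuous hab)
      (hg.absolutelyContinuous hab)) (Integrable.add ?_ ?_) ?_
  · refine Integrable.mono' ((hf.integrable.norm.const_mul (‖B‖ * D)))
      (B.aestronglyMeasurable_comp₂ hf.integrable.aestronglyMeasurable mg) ?_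
    filter_upwards [ae_restrict_mem measurableSet_Ioo] with x hx
    calc ‖B (f' x) (g x)‖ ≤ ‖B‖ * ‖f' x‖ * ‖g x‖ := B.le_opNorm₂ _ _
      _ ≤ ‖B‖ * ‖f' x‖ * D := by gcongr; exact hD x (Ioo_subset_Icc_self hx)
      _ = ‖B‖ * D * ‖f' x‖ := by ring
  · refine Integrable.mono' ((hg.integrable.norm.const_mul (‖B‖ * C)))
      (B.aestronglyMeasurable_comp₂ mf hg.integrable.aestronglyMeasurable) ?_
    filter_upwards [ae_restrict_mem measurableSet_Ioo] with x hx
    calc ‖B (f x) (g' x)‖ ≤ ‖B‖ * ‖f x‖ * ‖g' x‖ := B.le_opNorm₂ _ _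
      _ ≤ ‖B‖ * C * ‖g' x‖ := by gcongr; exact hC x (Ioo_subset_Icc_self hx)
  · filter_upwards [hf.ae_hasDerivAt hab, hg.ae_hasDerivAt hab] with x h1 h2
    simpa [add_comm] using B.hasDerivAt_of_bilinear (fun _ => h1) (fun _ => h2)

theorem inv {f f' : ℝ → ℝ} (h : IsPrimitive a b f f') (hab : a ≤ b)
    (h0 : ∀ x ∈ Icc a b, f x ≠ 0) :
    IsPrimitive a b (fun x => (f x)⁻¹) (fun x => -((f x)⁻¹ * (f x)⁻¹) * f' x) := by
  have cf := (h.continuousOn hab).inv₀ h0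
  obtain ⟨C, hC⟩ := isCompact_Icc.exists_bound_of_continuousOn (cf.mul cf).neg
  refine of_absolutelyContinuous hab (AbsolutelyContinuousOnInterval.inv
    (h.absolutelyContinuous hab) (by rwa [uIcc_of_le hab])) ?_ ?_
  · refine Integrable.bdd_mul (c := C) h.integrable
      (((cf.mul cf).neg.mono Ioo_subset_Icc_self).aestronglyMeasurable measurableSet_Ioo) ?_
    filter_upwards [ae_restrict_mem measurableSet_Ioo] with x hx
    exact hC x (Ioo_subset_Icc_self hx)
  · filter_upwards [h.ae_hasDerivAt hab, ae_restrict_mem measurableSet_Ioo] with x h1 hx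
    have hx0 := h0 x (Ioo_subset_Icc_self hx)
    refine (h1.inv hx0).congr_deriv ?_
    field_simp

end IsPrimitive

/-! ### Weak derivatives and primitives -/

section WeakDerivative

variable {E : Type*} [NormedAddCommGroup E] [NormedSpace ℝ E] {a b : ℝ}

theorem exists_tsupport_subset_Icc {θ : ℝ → ℝ} (hab : a < b) (hc : HasCompactSupport θ)
    (hs : tsupport θ ⊆ Ioo a b) : ∃ c d, a < c ∧ d < b ∧ tsupport θ ⊆ Icc c d := by
  rcases (tsupport θ).eq_empty_or_nonempty with h | h
  · exact ⟨(a + b) / 2, (a + b) / 2, by linarith, by linarith, by simp [h]⟩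
  · obtain ⟨c, hc1, hc2⟩ := hc.isCompact.exists_isLeast h
    obtain ⟨d, hd1, hd2⟩ := hc.isCompact.exists_isGreatest h
    exact ⟨c, d, (hs hc1).1, (hs hd1).2, fun x hx => ⟨hc2 hx, hd2 hx⟩⟩

/-- A test function of `(a, b)` with vanishing integral is the derivative of a test function. -/
theorem exists_testFunction_deriv_eq {θ : ℝ → ℝ} (hab : a < b) (hθ : ContDiff ℝ (⊤ : ℕ∞) θ)
    (hc : HasCompactSupport θ) (hs : tsupport θ ⊆ Ioo a b) (h0 : ∫ x in Ioo a b, θ x = 0) :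
    ∃ ψ : ℝ → ℝ, ContDiff ℝ (⊤ : ℕ∞) ψ ∧ HasCompactSupport ψ ∧ tsupport ψ ⊆ Ioo a b ∧
      deriv ψ = θ := by
  obtain ⟨c, d, hac, hdb, hcd⟩ := exists_tsupport_subset_Icc hab hc hs
  have hz : ∀ x, x ∉ Icc c d → θ x = 0 := fun x hx => image_eq_zero_of_notMem_tsupport
    (fun h => hx (hcd h))
  have hd : ∀ x, HasDerivAt (fun x => ∫ s in a..x, θ s) (θ x) x := fun x =>
    intervalIntegral.integral_hasDerivAt_right (hθ.continuous.intervalIntegrable _ _)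
      hθ.continuous.stronglyMeasurable.stronglyMeasurableAtFilter hθ.continuous.continuousAt
  have hder : deriv (fun x => ∫ s in a..x, θ s) = θ := funext fun x => (hd x).deriv
  have hsup : Function.support (fun x => ∫ s in a..x, θ s) ⊆ Icc c d := by
    intro x hx
    by_contra hxI
    apply hx
    rw [mem_Icc, not_and_or, not_le, not_le] at hxI
    rcases hxI with hxc | hxd
    · refine intervalIntegral.integral_zero_ae (Eventually.of_forall fun y hy => hz y fun hy' => ?_)
      rw [mem_uIoc] at hy
      rcases hy with hy | hy
      · exact absurd (hy'.1.trans hy.2) (not_le.2 hxc)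
      · exact absurd (hy'.1.trans hy.2) (not_le.2 hac)
    · have e1 : ∫ s in a..b, θ s = 0 := by rw [intervalIntegral_eq_setIntegral_Ioo hab.le, h0]
      have e2 : ∫ s in b..x, θ s = 0 := by
        refine intervalIntegral.integral_zero_ae
          (Eventually.of_forall fun y hy => hz y fun hy' => ?_)
        rw [mem_uIoc] at hy
        rcases hy with hy | hy
        · exact absurd (hy.1.trans_le hy'.2) (not_lt.2 hdb.le)
        · exact absurd (hy.1.trans_le hy'.2) (not_lt.2 hxd.le)
      change ∫ s in a..x, θ s = 0
      rw [← intervalIntegral.integral_add_adjacent_intervals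
        (hθ.continuous.intervalIntegrable a b) (hθ.continuous.intervalIntegrable b x), e1, e2,
        add_zero]
  have hts : tsupport (fun x => ∫ s in a..x, θ s) ⊆ Icc c d := closure_minimal hsup isClosed_Icc
  refine ⟨_, ?_, HasCompactSupport.of_support_subset_isCompact isCompact_Icc hsup,
    hts.trans fun x hx => ⟨hac.trans_le hx.1, hx.2.trans_lt hdb⟩, hder⟩
  exact contDiff_infty_iff_deriv.2 ⟨fun x => (hd x).differentiableAt, by rwa [hder]⟩

theorem exists_testFunction_integral_eq_one (hab : a < b) :
    ∃ χ : ℝ → ℝ, ContDiff ℝ (⊤ : ℕ∞) χ ∧ HasCompactSupport χ ∧ tsupport χ ⊆ Ioo a b ∧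
      ∫ x in Ioo a b, χ x = 1 := by
  let f : ContDiffBump ((a + b) / 2) := ⟨(b - a) / 8, (b - a) / 4, by linarith, by linarith⟩
  have hs : tsupport (f.normed volume) ⊆ Ioo a b := by
    rw [f.tsupport_normed_eq, Real.closedBall_eq_Icc]
    intro x hx
    have h1 := hx.1
    have h2 := hx.2
    simp only [f] at h1 h2
    exact ⟨by linarith, by linarith⟩
  refine ⟨f.normed volume, f.contDiff_normed, f.hasCompactSupport_normed, hs, ?_⟩
  rw [setIntegral_eq_integral_of_forall_compl_eq_zero, f.integral_normed]
  exact fun x hx => image_eq_zero_of_notMem_tsupport fun h => hx (hs h)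

/-- **Du Bois-Reymond lemma**: a continuous function with vanishing weak derivative is constant. -/
theorem exists_eq_const_of_integral_deriv_smul_eq_zero [CompleteSpace E] (hab : a < b) {h : ℝ → E}
    (hcont : ContinuousOn h (Icc a b))
    (H : ∀ φ : ℝ → ℝ, ContDiff ℝ (⊤ : ℕ∞) φ → HasCompactSupport φ → tsupport φ ⊆ Ioo a b →
      ∫ x in Ioo a b, deriv φ x • h x = 0) : ∃ c, ∀ x ∈ Icc a b, h x = c := by
  obtain ⟨χ, hχ, hχc, hχs, hχ1⟩ := exists_testFunction_integral_eq_one hab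
  have hint : ∀ φ : ℝ → ℝ, Continuous φ → IntegrableOn (fun x => φ x • h x) (Ioo a b) :=
    fun φ hφ => ((hφ.continuousOn.smul hcont).integrableOn_Icc).mono_set Ioo_subset_Icc_self
  set c := ∫ x in Ioo a b, χ x • h x with hcdef
  have hae : ∀ᵐ x, x ∈ Ioo a b → h x - c = 0 := by
    refine isOpen_Ioo.ae_eq_zero_of_integral_contDiff_smul_eq_zero
      (((hcont.mono Ioo_subset_Icc_self).sub continuousOn_const).locallyIntegrableOn
        measurableSet_Ioo) fun φ hφ hφc hφs => ?_
    rw [← setIntegral_eq_integral_of_forall_compl_eq_zero (s := Ioo a b) (fun x hx => by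
      rw [image_eq_zero_of_notMem_tsupport fun h' => hx (hφs h'), zero_smul])]
    -- `φ - (∫ φ) χ` has vanishing integral, so it is the derivative of a test function.
    set m := ∫ x in Ioo a b, φ x with hm
    have hφi : IntegrableOn φ (Ioo a b) :=
      hφ.continuous.integrableOn_Icc.mono_set Ioo_subset_Icc_self
    have hχi : IntegrableOn χ (Ioo a b) :=
      hχ.continuous.integrableOn_Icc.mono_set Ioo_subset_Icc_self
    have hsub : tsupport (fun x => φ x - m * χ x) ⊆ tsupport φ ∪ tsupport χ :=
      (tsupport_sub _ _).trans (union_subset_union_right _ (tsupport_mul_subset_right))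
    obtain ⟨ψ, h1, h2, h3, h4⟩ := exists_testFunction_deriv_eq (θ := fun x => φ x - m * χ x) hab
      (hφ.sub (contDiff_const.mul hχ)) (hφc.sub hχc.mul_left)
      (hsub.trans (union_subset hφs hχs)) (by
        rw [integral_sub hφi (hχi.const_mul m), integral_const_mul, hχ1, mul_one, hm, sub_self])
    have h5 := H ψ h1 h2 h3
    simp only [h4, sub_smul, mul_smul] at h5
    rw [integral_sub (hint φ hφ.continuous) (Integrable.fun_smul m (hint χ hχ.continuous)),
      integral_smul] at h5
    simp only [smul_sub]
    rw [integral_sub (hint φ hφ.continuous) (hφi.smul_const c), integral_smul_const]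
    exact h5
  have heq : EqOn h (fun _ => c) (Ioo a b) := by
    have := (ae_restrict_iff' (measurableSet_Ioo (a := a) (b := b))).2 hae
    refine Measure.eqOn_open_of_ae_eq (μ := volume) ?_ isOpen_Ioo
      (hcont.mono Ioo_subset_Icc_self) continuousOn_const
    filter_upwards [this] with x hx
    exact sub_eq_zero.1 hx
  refine ⟨c, fun x hx => ?_⟩
  have hcl : closure (Ioo a b) = Icc a b := closure_Ioo hab.ne
  exact (heq.of_subset_closure hcont continuousOn_const Ioo_subset_Icc_self hcl.ge) hx

theorem IsPrimitive.hasWeakDeriv [CompleteSpace E] {f g : ℝ → E} (h : IsPrimitive a b f g)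
    (hab : a < b) : HasWeakDeriv a b f g := by
  intro φ hφ hφc hφs
  have hφ1 : ContDiff ℝ 1 φ := hφ.of_le (by exact_mod_cast le_top)
  have hφp : IsPrimitive a b φ (deriv φ) := IsPrimitive.of_hasDerivAt
    (fun x => (hφ1.differentiable one_ne_zero x).hasDerivAt) (hφ1.continuous_deriv le_rfl)
  have hprod := hφp.bilinear (ContinuousLinearMap.lsmul ℝ ℝ) h hab.le
  have h1 := hprod.integral_eq_sub hab.le
  have ha : φ a = 0 := image_eq_zero_of_notMem_tsupport fun h' => left_notMem_Ioo (hφs h')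
  have hb : φ b = 0 := image_eq_zero_of_notMem_tsupport fun h' => right_notMem_Ioo (hφs h')
  simp only [ContinuousLinearMap.lsmul_apply, ha, hb, zero_smul, sub_zero] at h1
  have i1 : IntegrableOn (fun x => deriv φ x • f x) (Ioo a b) :=
    (((hφ1.continuous_deriv le_rfl).continuousOn.smul
      (h.continuousOn hab.le)).integrableOn_Icc).mono_set Ioo_subset_Icc_self
  have i2 : IntegrableOn (fun x => φ x • g x) (Ioo a b) := by
    have := hprod.integrable.sub i1
    exact this.congr (ae_of_all _ fun x => by simp)
  rw [integral_add i1 i2] at h1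
  exact eq_neg_of_add_eq_zero_left h1

theorem HasWeakDeriv.isPrimitive [CompleteSpace E] {f g : ℝ → E} (hab : a < b)
    (hf : ContinuousOn f (Icc a b)) (hg : IntegrableOn g (Ioo a b)) (h : HasWeakDeriv a b f g) :
    IsPrimitive a b f g := by
  have hG : IsPrimitive a b (fun x => ∫ s in a..x, g s) g := ⟨hg, fun x _ => by simp⟩
  have hGc := hG.continuousOn hab.le
  obtain ⟨c, hc⟩ := exists_eq_const_of_integral_deriv_smul_eq_zero
    (h := fun x => f x - ∫ s in a..x, g s) hab (hf.sub hGc) fun φ hφ hφc hφs => by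
      have hφ' : Continuous (deriv φ) := hφ.continuous_deriv (by simp)
      have hi : ∀ k : ℝ → E, ContinuousOn k (Icc a b) →
          IntegrableOn (fun x => deriv φ x • k x) (Ioo a b) := fun k hk =>
        ((hφ'.continuousOn.smul hk).integrableOn_Icc).mono_set Ioo_subset_Icc_self
      simp only [smul_sub]
      rw [integral_sub (hi _ hf) (hi _ hGc), h φ hφ hφc hφs, hG.hasWeakDeriv hab φ hφ hφc hφs,
        sub_self]
  refine ⟨hg, fun x hx => ?_⟩
  have h1 := hc x hx
  have h2 := hc a (left_mem_Icc.2 hab.le)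
  simp only [intervalIntegral.integral_same, sub_zero] at h1 h2
  rw [h2, ← h1]
  abel

/-- No hypothesis on `f` is needed, since `weakDeriv` is `0` outside `H¹`. -/
theorem memLp_weakDeriv (f : ℝ → E) :
    MemLp (weakDeriv a b f) 2 (volume.restrict (Ioo a b)) := by
  unfold weakDeriv
  split_ifs with h
  · exact h.choose_spec.1
  · exact MemLp.zero

theorem integrableOn_of_memLp_two {F : Type*} [NormedAddCommGroup F] {f : ℝ → F}
    (h : MemLp f 2 (volume.restrict (Ioo a b))) :
    IntegrableOn f (Ioo a b) :=
  h.integrable one_le_two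

theorem MemH1.isPrimitive [CompleteSpace E] {f : ℝ → E} (hab : a < b) (h : MemH1 a b f) :
    IsPrimitive a b f (weakDeriv a b f) := by
  refine HasWeakDeriv.isPrimitive hab h.1 (integrableOn_of_memLp_two (memLp_weakDeriv f)) ?_
  rw [weakDeriv, dif_pos h.2]
  exact h.2.choose_spec.2

theorem IsPrimitive.memH1 [CompleteSpace E] {f g : ℝ → E} (hab : a < b) (h : IsPrimitive a b f g)
    (hg : MemLp g 2 (volume.restrict (Ioo a b))) : MemH1 a b f :=
  ⟨h.continuousOn hab.le, g, hg, h.hasWeakDeriv hab⟩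

/-- The weak derivative is unique almost everywhere, so the one chosen by `weakDeriv` may be replaced
by any explicit one. -/
theorem IsPrimitive.weakDeriv_ae_eq [CompleteSpace E] {f g : ℝ → E} (hab : a < b)
    (h : IsPrimitive a b f g) (hg : MemLp g 2 (volume.restrict (Ioo a b))) :
    weakDeriv a b f =ᵐ[volume.restrict (Ioo a b)] g :=
  ((h.memH1 hab hg).isPrimitive hab).ae_unique h hab.le

theorem memLp_two_of_continuousOn {F : Type*} [NormedAddCommGroup F] {f : ℝ → F}
    (hf : ContinuousOn f (Icc a b)) :
    MemLp f 2 (volume.restrict (Ioo a b)) := by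
  obtain ⟨C, hC⟩ := isCompact_Icc.exists_bound_of_continuousOn hf
  refine MemLp.of_bound ((hf.mono Ioo_subset_Icc_self).aestronglyMeasurable measurableSet_Ioo) C ?_
  filter_upwards [ae_restrict_mem measurableSet_Ioo] with x hx
  exact hC x (Ioo_subset_Icc_self hx)

end WeakDerivative

/-! ### Calculus in `H¹` -/

section H1

variable {E G W : Type*} [NormedAddCommGroup E] [NormedSpace ℝ E] [NormedAddCommGroup G]
  [NormedSpace ℝ G] [NormedAddCommGroup W] [NormedSpace ℝ W] {a b : ℝ}

/-- `f` is a function of `H¹((a, b), E)` with derivative `g`. -/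
structure HasH1Deriv (a b : ℝ) (f g : ℝ → E) : Prop extends IsPrimitive a b f g where
  memLp : MemLp g 2 (volume.restrict (Ioo a b))

theorem MemH1.hasH1Deriv [CompleteSpace E] {f : ℝ → E} (hab : a < b) (h : MemH1 a b f) :
    HasH1Deriv a b f (weakDeriv a b f) :=
  ⟨h.isPrimitive hab, memLp_weakDeriv f⟩

theorem memLp_bilinear_left (B : E →L[ℝ] G →L[ℝ] W) {f : ℝ → E} {g : ℝ → G}
    (hf : MemLp f 2 (volume.restrict (Ioo a b))) (hg : ContinuousOn g (Icc a b)) :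
    MemLp (fun x => B (f x) (g x)) 2 (volume.restrict (Ioo a b)) := by
  obtain ⟨D, hD⟩ := isCompact_Icc.exists_bound_of_continuousOn hg
  refine hf.of_le_mul (c := ‖B‖ * D) (B.aestronglyMeasurable_comp₂ hf.aestronglyMeasurable
    ((hg.mono Ioo_subset_Icc_self).aestronglyMeasurable measurableSet_Ioo)) ?_
  filter_upwards [ae_restrict_mem measurableSet_Ioo] with x hx
  calc ‖B (f x) (g x)‖ ≤ ‖B‖ * ‖f x‖ * ‖g x‖ := B.le_opNorm₂ _ _
    _ ≤ ‖B‖ * ‖f x‖ * D := by gcongr; exact hD x (Ioo_subset_Icc_self hx)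
    _ = ‖B‖ * D * ‖f x‖ := by ring

theorem memLp_bilinear_right (B : E →L[ℝ] G →L[ℝ] W) {f : ℝ → E} {g : ℝ → G}
    (hf : ContinuousOn f (Icc a b)) (hg : MemLp g 2 (volume.restrict (Ioo a b))) :
    MemLp (fun x => B (f x) (g x)) 2 (volume.restrict (Ioo a b)) :=
  memLp_bilinear_left B.flip hg hf

theorem integrable_bilinear (B : E →L[ℝ] G →L[ℝ] W) {f : ℝ → E} {g : ℝ → G}
    (hf : MemLp f 2 (volume.restrict (Ioo a b))) (hg : MemLp g 2 (volume.restrict (Ioo a b))) :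
    IntegrableOn (fun x => B (f x) (g x)) (Ioo a b) := by
  refine ((hf.norm.integrable_mul hg.norm).const_mul ‖B‖).mono'
    (B.aestronglyMeasurable_comp₂ hf.aestronglyMeasurable hg.aestronglyMeasurable)
    (ae_of_all _ fun x => ?_)
  simpa [mul_assoc] using B.le_opNorm₂ (f x) (g x)

namespace HasH1Deriv

theorem congr {f₁ f₂ g₁ g₂ : ℝ → E} (h : HasH1Deriv a b f₁ g₁) (hab : a ≤ b)
    (hf : EqOn f₁ f₂ (Icc a b)) (hg : g₁ =ᵐ[volume.restrict (Ioo a b)] g₂) :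
    HasH1Deriv a b f₂ g₂ :=
  ⟨h.toIsPrimitive.congr hab hf hg, (memLp_congr_ae hg).1 h.memLp⟩

theorem weakDeriv_ae_eq [CompleteSpace E] {f g : ℝ → E} (h : HasH1Deriv a b f g) (hab : a < b) :
    weakDeriv a b f =ᵐ[volume.restrict (Ioo a b)] g :=
  h.toIsPrimitive.weakDeriv_ae_eq hab h.memLp

theorem memLp_self {f g : ℝ → E} (h : HasH1Deriv a b f g) (hab : a ≤ b) :
    MemLp f 2 (volume.restrict (Ioo a b)) :=
  memLp_two_of_continuousOn (h.continuousOn hab)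

theorem const (c : E) : HasH1Deriv a b (fun _ => c) (fun _ => 0) :=
  ⟨IsPrimitive.const c, MemLp.zero⟩

theorem add {f₁ f₂ g₁ g₂ : ℝ → E} (h₁ : HasH1Deriv a b f₁ g₁) (h₂ : HasH1Deriv a b f₂ g₂)
    (hab : a ≤ b) : HasH1Deriv a b (fun x => f₁ x + f₂ x) (fun x => g₁ x + g₂ x) :=
  ⟨h₁.toIsPrimitive.add h₂.toIsPrimitive hab, h₁.memLp.add h₂.memLp⟩

theorem sub {f₁ f₂ g₁ g₂ : ℝ → E} (h₁ : HasH1Deriv a b f₁ g₁) (h₂ : HasH1Deriv a b f₂ g₂)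
    (hab : a ≤ b) : HasH1Deriv a b (fun x => f₁ x - f₂ x) (fun x => g₁ x - g₂ x) :=
  ⟨h₁.toIsPrimitive.sub h₂.toIsPrimitive hab, h₁.memLp.sub h₂.memLp⟩

theorem const_smul {f g : ℝ → E} (c : ℝ) (h : HasH1Deriv a b f g) :
    HasH1Deriv a b (fun x => c • f x) (fun x => c • g x) :=
  ⟨h.toIsPrimitive.const_smul c, h.memLp.const_smul c⟩

theorem clm_comp [CompleteSpace E] [CompleteSpace G] {f g : ℝ → E} (L : E →L[ℝ] G)
    (h : HasH1Deriv a b f g) (hab : a ≤ b) :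
    HasH1Deriv a b (fun x => L (f x)) (fun x => L (g x)) :=
  ⟨h.toIsPrimitive.clm_comp L hab, L.comp_memLp' h.memLp⟩

theorem of_hasDerivAt [CompleteSpace E] {f g : ℝ → E} (h : ∀ x, HasDerivAt f (g x) x)
    (hg : Continuous g) : HasH1Deriv a b f g :=
  ⟨IsPrimitive.of_hasDerivAt h hg, memLp_two_of_continuousOn hg.continuousOn⟩

theorem bilinear [CompleteSpace E] [CompleteSpace G] [CompleteSpace W] {f f' : ℝ → E}
    {g g' : ℝ → G} (B : E →L[ℝ] G →L[ℝ] W) (hf : HasH1Deriv a b f f') (hg : HasH1Deriv a b g g')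
    (hab : a ≤ b) :
    HasH1Deriv a b (fun x => B (f x) (g x)) (fun x => B (f' x) (g x) + B (f x) (g' x)) :=
  ⟨hf.toIsPrimitive.bilinear B hg.toIsPrimitive hab,
    (memLp_bilinear_left B hf.memLp (hg.continuousOn hab)).add
      (memLp_bilinear_right B (hf.continuousOn hab) hg.memLp)⟩

theorem inv {f f' : ℝ → ℝ} (h : HasH1Deriv a b f f') (hab : a ≤ b)
    (h0 : ∀ x ∈ Icc a b, f x ≠ 0) :
    HasH1Deriv a b (fun x => (f x)⁻¹) (fun x => -((f x)⁻¹ * (f x)⁻¹) * f' x) := by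
  have cf := (h.continuousOn hab).inv₀ h0
  exact ⟨h.toIsPrimitive.inv hab h0,
    memLp_bilinear_right (ContinuousLinearMap.mul ℝ ℝ) (cf.mul cf).neg h.memLp⟩

end HasH1Deriv

/-! ### The Sobolev embedding -/

/-- Cauchy-Schwarz inequality, from the nonnegativity of the variance of `‖f‖`. -/
theorem sq_integral_norm_le {F : Type*} [NormedAddCommGroup F] {f : ℝ → F} (hab : a < b)
    (hf : MemLp f 2 (volume.restrict (Ioo a b))) :
    (∫ x in Ioo a b, ‖f x‖) ^ 2 ≤ (b - a) * ∫ x in Ioo a b, ‖f x‖ ^ 2 := by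
  set I := ∫ x in Ioo a b, ‖f x‖
  have h1 : Integrable (fun x => ‖f x‖) (volume.restrict (Ioo a b)) :=
    integrableOn_of_memLp_two hf.norm
  have h2 : Integrable (fun x => ‖f x‖ ^ 2) (volume.restrict (Ioo a b)) := hf.norm.integrable_sq
  have h3 : 0 ≤ ∫ x in Ioo a b, ((b - a) * ‖f x‖ - I) ^ 2 := by positivity
  have e : ∀ x, ((b - a) * ‖f x‖ - I) ^ 2
      = (b - a) ^ 2 * ‖f x‖ ^ 2 - 2 * (b - a) * I * ‖f x‖ + I ^ 2 := fun x => by ring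
  simp only [e] at h3
  have h12 : Integrable (fun x => (b - a) ^ 2 * ‖f x‖ ^ 2 - 2 * (b - a) * I * ‖f x‖)
      (volume.restrict (Ioo a b)) := (h2.const_mul _).sub (h1.const_mul _)
  rw [integral_add h12 (integrable_const _),
    integral_sub (h2.const_mul _) (h1.const_mul _), integral_const_mul, integral_const_mul,
    integral_const] at h3
  simp only [measureReal_restrict_apply_univ, Real.volume_real_Ioo_of_le hab.le,
    smul_eq_mul] at h3
  have h4 : 0 < b - a := sub_pos.2 hab
  change 0 ≤ (b - a) ^ 2 * _ - 2 * (b - a) * I * I + (b - a) * I ^ 2 at h3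
  have h5 : 0 ≤ (b - a) * ((b - a) * (∫ x in Ioo a b, ‖f x‖ ^ 2) - I ^ 2) := by linarith
  have := nonneg_of_mul_nonneg_right h5 h4
  linarith

/-- A constant of the embedding of `H¹((a, b))` into the continuous functions on `[a, b]`. -/
def sobolevConst (a b : ℝ) : ℝ := Real.sqrt (b - a) / (b - a) + Real.sqrt (b - a)

theorem sobolevConst_pos (hab : a < b) : 0 < sobolevConst a b := by
  have : 0 < b - a := sub_pos.2 hab
  unfold sobolevConst
  positivity

theorem h1norm_nonneg (f : ℝ → E) : 0 ≤ h1norm a b f := Real.sqrt_nonneg _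

theorem sq_h1norm (f : ℝ → E) : h1norm a b f ^ 2 =
    (∫ x in Ioo a b, ‖f x‖ ^ 2) + ∫ x in Ioo a b, ‖weakDeriv a b f x‖ ^ 2 :=
  Real.sq_sqrt (by positivity)

/-- Sobolev embedding: `‖f x‖ ≤ ‖f y‖ + ∫ ‖f'‖` is averaged over `y`. -/
theorem MemH1.norm_le_h1norm [CompleteSpace E] {f : ℝ → E} (hab : a < b) (h : MemH1 a b f) {x : ℝ}
    (hx : x ∈ Icc a b) : ‖f x‖ ≤ sobolevConst a b * h1norm a b f := by
  have hf := h.hasH1Deriv hab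
  have hba : 0 < b - a := sub_pos.2 hab
  set n := h1norm a b f with hn
  have hn0 : 0 ≤ n := h1norm_nonneg f
  have hn2 := sq_h1norm (a := a) (b := b) f
  have p1 : 0 ≤ ∫ x in Ioo a b, ‖f x‖ ^ 2 := by positivity
  have p2 : 0 ≤ ∫ x in Ioo a b, ‖weakDeriv a b f x‖ ^ 2 := by positivity
  have key : ∀ k : ℝ → E, MemLp k 2 (volume.restrict (Ioo a b)) →
      (∫ x in Ioo a b, ‖k x‖ ^ 2) ≤ n ^ 2 → ∫ x in Ioo a b, ‖k x‖ ≤ Real.sqrt (b - a) * n := by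
    intro k hk hk2
    refine abs_le_of_sq_le_sq' ?_ (by positivity) |>.2
    rw [mul_pow, Real.sq_sqrt hba.le]
    exact (sq_integral_norm_le hab hk).trans (by gcongr)
  have k1 := key f (hf.memLp_self hab.le) (by rw [hn, hn2]; linarith)
  have k2 := key _ hf.memLp (by rw [hn, hn2]; linarith)
  have hdiff : ∀ y ∈ Ioo a b, ‖f x‖ ≤ ‖f y‖ + Real.sqrt (b - a) * n := by
    intro y hy
    have hy' := Ioo_subset_Icc_self hy
    have hi := hf.intervalIntegrable hab.le
    have hxu : x ∈ uIcc a b := by rwa [uIcc_of_le hab.le]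
    have hyu : y ∈ uIcc a b := by rwa [uIcc_of_le hab.le]
    have e : f x - f y = ∫ s in y..x, weakDeriv a b f s := by
      rw [hf.eq_add_integral x hx, hf.eq_add_integral y hy', add_sub_add_left_eq_sub,
        intervalIntegral.integral_interval_sub_left (hi.mono_set (uIcc_subset_uIcc_left hxu))
        (hi.mono_set (uIcc_subset_uIcc_left hyu))]
    have h3 : ‖f x - f y‖ ≤ ∫ s in Ioo a b, ‖weakDeriv a b f s‖ := by
      rw [e, ← integral_Ioc_eq_integral_Ioo]
      refine (intervalIntegral.norm_integral_le_integral_norm_uIoc).trans ?_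
      refine setIntegral_mono_set ?_ (ae_of_all _ fun _ => norm_nonneg _) ?_
      · exact ((intervalIntegrable_iff_integrableOn_Ioc_of_le hab.le).1 hi).norm
      · refine LE.le.eventuallyLE fun z hz => ?_
        rw [mem_uIoc] at hz
        rcases hz with hz | hz
        · exact ⟨hy.1.trans hz.1, hz.2.trans hx.2⟩
        · exact ⟨hx.1.trans_lt hz.1, hz.2.trans hy.2.le⟩
    have h4 : ‖f x‖ ≤ ‖f y‖ + ‖f x - f y‖ := by
      simpa using norm_add_le (f y) (f x - f y)
    linarith
  have h5 : ∫ y in Ioo a b, ‖f x‖ ≤ ∫ y in Ioo a b, (‖f y‖ + Real.sqrt (b - a) * n) := by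
    have hfi : IntegrableOn (fun y => ‖f y‖) (Ioo a b) :=
      integrableOn_of_memLp_two (hf.memLp_self hab.le).norm
    refine setIntegral_mono_on (integrable_const _) (hfi.add (integrable_const _))
      measurableSet_Ioo hdiff
  rw [integral_add (integrableOn_of_memLp_two (hf.memLp_self hab.le).norm) (integrable_const _),
    integral_const, integral_const] at h5
  simp only [measureReal_restrict_apply_univ, Real.volume_real_Ioo_of_le hab.le,
    smul_eq_mul] at h5
  have h6 : (b - a) * ‖f x‖ ≤ (b - a) * (sobolevConst a b * n) := by
    have : (b - a) * (sobolevConst a b * n)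
        = Real.sqrt (b - a) * n + (b - a) * (Real.sqrt (b - a) * n) := by
      unfold sobolevConst
      field_simp
    linarith
  exact le_of_mul_le_mul_left h6 hba

end H1

/-! ### Time derivatives of curves in `H¹` -/

section TimeDerivative

variable {E X : Type*} [NormedAddCommGroup E] [InnerProductSpace ℝ E]
  [NormedAddCommGroup X] [NormedSpace ℝ X] {a b : ℝ}

theorem integrable_inner {f g : ℝ → E} (hf : MemLp f 2 (volume.restrict (Ioo a b)))
    (hg : MemLp g 2 (volume.restrict (Ioo a b))) :
    IntegrableOn (fun x => inner ℝ (f x) (g x)) (Ioo a b) :=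
  integrable_bilinear (innerSL ℝ) hf hg

theorem HasH1Deriv.pi_combination {f f' g g' h h' : ℝ → E} (hf : HasH1Deriv a b f f')
    (hg : HasH1Deriv a b g g') (hh : HasH1Deriv a b h h') (hab : a ≤ b) (c : ℝ) :
    HasH1Deriv a b (c • (f - g) - h) (c • (f' - g') - h') :=
  ((hf.sub hg hab).const_smul c).sub hh hab

open Classical in
/-- The class in `L²((a, b), E)` of a function, and `0` if the function is not square integrable. -/
def toL2 {F : Type*} [NormedAddCommGroup F] (a b : ℝ) (f : ℝ → F) :
    Lp F 2 (volume.restrict (Ioo a b)) :=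
  if h : MemLp f 2 (volume.restrict (Ioo a b)) then h.toLp f else 0

theorem toL2_eq {F : Type*} [NormedAddCommGroup F] {f : ℝ → F}
    (h : MemLp f 2 (volume.restrict (Ioo a b))) :
    toL2 a b f = h.toLp f := dif_pos h

theorem inner_toL2 {f g : ℝ → E} (hf : MemLp f 2 (volume.restrict (Ioo a b)))
    (hg : MemLp g 2 (volume.restrict (Ioo a b))) :
    inner ℝ (toL2 a b f) (toL2 a b g) = ∫ x in Ioo a b, inner ℝ (f x) (g x) := by
  rw [toL2_eq hf, toL2_eq hg, L2.inner_def]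
  refine integral_congr_ae ?_
  filter_upwards [hf.coeFn_toLp, hg.coeFn_toLp] with x h1 h2
  rw [h1, h2]

theorem sq_norm_toL2 {f : ℝ → E} (hf : MemLp f 2 (volume.restrict (Ioo a b))) :
    ‖toL2 a b f‖ ^ 2 = ∫ x in Ioo a b, ‖f x‖ ^ 2 := by
  rw [← real_inner_self_eq_norm_sq, inner_toL2 hf hf]
  simp

theorem toL2_combination {f g k l : ℝ → E} (hf : MemLp f 2 (volume.restrict (Ioo a b)))
    (hg : MemLp g 2 (volume.restrict (Ioo a b))) (hk : MemLp k 2 (volume.restrict (Ioo a b)))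
    (c : ℝ) (hl : l =ᵐ[volume.restrict (Ioo a b)] c • (f - g) - k) :
    toL2 a b l = c • (toL2 a b f - toL2 a b g) - toL2 a b k := by
  have h1 : MemLp (c • (f - g) - k) 2 (volume.restrict (Ioo a b)) :=
    ((hf.sub hg).const_smul c).sub hk
  have h2 : MemLp l 2 (volume.restrict (Ioo a b)) := (memLp_congr_ae hl).2 h1
  rw [toL2_eq h2, toL2_eq hf, toL2_eq hg, toL2_eq hk, ← MemLp.toLp_sub, ← MemLp.toLp_const_smul,
    ← MemLp.toLp_sub]
  exact MemLp.toLp_congr h2 _ hl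

variable [CompleteSpace E]

/-- A map that is linear on `H¹` and bounded for the `H¹` norm commutes with the time derivative
of a curve of class `C¹` with values in `H¹`. -/
theorem IsC1H1.hasDerivWithinAt_of_bounded {N V : ℝ → ℝ → E} (hab : a < b) (h : IsC1H1 a b N V)
    (Φ : (ℝ → E) → X) (K : ℝ)
    (hlin : ∀ f g k : ℝ → E, MemH1 a b f → MemH1 a b g → MemH1 a b k → ∀ c : ℝ,
      Φ (c • (f - g) - k) = c • (Φ f - Φ g) - Φ k)
    (hbd : ∀ f : ℝ → E, MemH1 a b f → ‖Φ f‖ ≤ K * h1norm a b f) {t : ℝ} (ht : 0 ≤ t) :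
    HasDerivWithinAt (fun s => Φ (N s)) (Φ (V t)) (Ici 0) t := by
  rw [hasDerivWithinAt_iff_tendsto_slope, tendsto_iff_norm_sub_tendsto_zero]
  refine squeeze_zero' (Eventually.of_forall fun _ => norm_nonneg _) ?_
    (by simpa using (h.hasDeriv t ht).const_mul K)
  filter_upwards [self_mem_nhdsWithin] with s hs
  have h0 : 0 ≤ s := hs.1
  rw [slope_def_module, ← hlin _ _ _ (h.mem s h0) (h.mem t ht) (h.mem_deriv t ht)]
  refine hbd _ ?_
  have hc := ((h.mem s h0).hasH1Deriv hab).pi_combination ((h.mem t ht).hasH1Deriv hab)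
    ((h.mem_deriv t ht).hasH1Deriv hab) hab.le (s - t)⁻¹
  exact hc.toIsPrimitive.memH1 hab hc.memLp

theorem IsC1H1.hasDerivWithinAt_apply {N V : ℝ → ℝ → E} (hab : a < b) (h : IsC1H1 a b N V)
    {t : ℝ} (ht : 0 ≤ t) {x : ℝ} (hx : x ∈ Icc a b) :
    HasDerivWithinAt (fun s => N s x) (V t x) (Ici 0) t :=
  h.hasDerivWithinAt_of_bounded hab (fun f => f x) (sobolevConst a b)
    (fun _ _ _ _ _ _ _ => rfl) (fun _ hf => hf.norm_le_h1norm hab hx) ht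

theorem IsC1H1.hasDerivWithinAt_toL2 {N V : ℝ → ℝ → E} (hab : a < b) (h : IsC1H1 a b N V)
    {t : ℝ} (ht : 0 ≤ t) :
    HasDerivWithinAt (fun s => toL2 a b (N s)) (toL2 a b (V t)) (Ici 0) t := by
  refine h.hasDerivWithinAt_of_bounded hab (toL2 a b) 1 (fun f g k hf hg hk c => ?_)
    (fun f hf => ?_) ht
  · exact toL2_combination ((hf.hasH1Deriv hab).memLp_self hab.le)
      ((hg.hasH1Deriv hab).memLp_self hab.le) ((hk.hasH1Deriv hab).memLp_self hab.le) c (ae_eq_refl _)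
  · rw [one_mul, ← pow_le_pow_iff_left₀ (norm_nonneg _) (h1norm_nonneg f) two_ne_zero, sq_h1norm,
      sq_norm_toL2 ((hf.hasH1Deriv hab).memLp_self hab.le)]
    exact le_add_of_nonneg_right (by positivity)

theorem IsC1H1.hasDerivWithinAt_toL2_weakDeriv {N V : ℝ → ℝ → E} (hab : a < b)
    (h : IsC1H1 a b N V) {t : ℝ} (ht : 0 ≤ t) :
    HasDerivWithinAt (fun s => toL2 a b (weakDeriv a b (N s))) (toL2 a b (weakDeriv a b (V t)))
      (Ici 0) t := by
  refine h.hasDerivWithinAt_of_bounded hab (fun f => toL2 a b (weakDeriv a b f)) 1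
    (fun f g k hf hg hk c => ?_) (fun f hf => ?_) ht
  · exact toL2_combination (memLp_weakDeriv f) (memLp_weakDeriv g) (memLp_weakDeriv k) c
      (((hf.hasH1Deriv hab).pi_combination (hg.hasH1Deriv hab) (hk.hasH1Deriv hab) hab.le
        c).weakDeriv_ae_eq hab)
  · rw [one_mul, ← pow_le_pow_iff_left₀ (norm_nonneg _) (h1norm_nonneg f) two_ne_zero, sq_h1norm,
      sq_norm_toL2 (memLp_weakDeriv f)]
    exact le_add_of_nonneg_left (by positivity)

theorem lyapunov_eq_toL2 {f : ℝ → E3} (hab : a < b) (hf : MemH1 a b f) :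
    lyapunov a b f = 1 / 2 * ‖toL2 a b (weakDeriv a b f)‖ ^ 2 + (b - a) +
      inner ℝ (toL2 a b f) (toL2 a b (fun _ => e 2)) := by
  have hf2 := (hf.hasH1Deriv hab).memLp_self hab.le
  have he : MemLp (fun _ : ℝ => e 2) 2 (volume.restrict (Ioo a b)) := memLp_const _
  rw [sq_norm_toL2 (memLp_weakDeriv f), inner_toL2 hf2 he]
  have i1 : Integrable (fun x => 1 / 2 * ‖weakDeriv a b f x‖ ^ 2) (volume.restrict (Ioo a b)) :=
    (memLp_weakDeriv f).norm.integrable_sq.const_mul _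
  have i2 : Integrable (fun x => 1 / 2 * ‖weakDeriv a b f x‖ ^ 2 + 1)
    (volume.restrict (Ioo a b)) := i1.add (integrable_const _)
  have i3 : Integrable (fun x => inner ℝ (f x) (e 2)) (volume.restrict (Ioo a b)) :=
    integrable_inner hf2 he
  rw [lyapunov, integral_add i2 i3, integral_add i1 (integrable_const _), integral_const_mul]
  simp [hab.le]

/-- Chain rule for `ℒ = ‖N'‖² / 2 + ⟨N, e₃⟩ + const`, in the Hilbert space `L²`. -/
theorem IsC1H1.hasDerivWithinAt_lyapunov {N V : ℝ → ℝ → E3} (hab : a < b) (h : IsC1H1 a b N V)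
    {t : ℝ} (ht : 0 ≤ t) :
    HasDerivWithinAt (fun s => lyapunov a b (N s))
      (∫ ω in Ioo a b, (inner ℝ (weakDeriv a b (N t) ω) (weakDeriv a b (V t) ω) +
        inner ℝ (e 2) (V t ω))) (Ici 0) t := by
  have hV2 := ((h.mem_deriv t ht).hasH1Deriv hab).memLp_self hab.le
  have he : MemLp (fun _ : ℝ => e 2) 2 (volume.restrict (Ioo a b)) := memLp_const _
  have h1 := (h.hasDerivWithinAt_toL2_weakDeriv hab ht).norm_sq
  have h2 := (h.hasDerivWithinAt_toL2 hab ht).inner ℝ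
    (hasDerivWithinAt_const t (Ici 0) (toL2 a b (fun _ => e 2)))
  have h3 := ((h1.const_mul (1 / 2)).add_const (b - a)).add h2
  refine (h3.congr_deriv ?_).congr (fun s hs => lyapunov_eq_toL2 hab (h.mem s hs))
    (lyapunov_eq_toL2 hab (h.mem t ht))
  rw [inner_zero_right, zero_add, inner_toL2 hV2 he,
    inner_toL2 (memLp_weakDeriv _) (memLp_weakDeriv _),
    integral_add (integrable_inner (memLp_weakDeriv _) (memLp_weakDeriv _))
      (integrable_inner he hV2)]
  simp only [real_inner_comm (e 2)]
  ring

end TimeDerivative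

/-! ### The vector product and rotations -/

section Geometry

theorem inner_eq_sum (x y : E3) : inner ℝ x y = x 0 * y 0 + x 1 * y 1 + x 2 * y 2 := by
  simp [PiLp.inner_apply, Fin.sum_univ_three, mul_comm]

theorem inner_e_right (x : E3) (i : Fin 3) : inner ℝ x (e i) = x i := by
  simp [e, EuclideanSpace.inner_single_right]

theorem cross_apply_zero (x y : E3) : cross x y 0 = x 1 * y 2 - x 2 * y 1 := by
  simp [cross, cross_apply]

theorem cross_apply_one (x y : E3) : cross x y 1 = x 2 * y 0 - x 0 * y 2 := by
  simp [cross, cross_apply]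

theorem cross_apply_two (x y : E3) : cross x y 2 = x 0 * y 1 - x 1 * y 0 := by
  simp [cross, cross_apply]

/-- The vector product of `ℝ³` as a continuous bilinear map. -/
def crossL : E3 →L[ℝ] E3 →L[ℝ] E3 :=
  (LinearMap.mk₂ ℝ cross (fun x y z => by simp [cross]) (fun c x y => by simp [cross])
    (fun x y z => by simp [cross]) (fun c x y => by simp [cross])).toContinuousBilinearMap

theorem inner_cross_rotate (x y z : E3) : inner ℝ z (cross x y) = inner ℝ x (cross y z) := by
  simp only [inner_eq_sum, cross_apply_zero, cross_apply_one, cross_apply_two]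
  ring

theorem inner_cross_self_right (x y : E3) : inner ℝ y (cross x y) = 0 := by
  simp only [inner_eq_sum, cross_apply_zero, cross_apply_one, cross_apply_two]
  ring

theorem inner_cross_self_left (x y : E3) : inner ℝ x (cross x y) = 0 := by
  simp only [inner_eq_sum, cross_apply_zero, cross_apply_one, cross_apply_two]
  ring

theorem inner_cross_cross (x y z w : E3) : inner ℝ (cross x y) (cross z w) =
    inner ℝ x z * inner ℝ y w - inner ℝ x w * inner ℝ y z := by
  simp only [inner_eq_sum, cross_apply_zero, cross_apply_one, cross_apply_two]
  ring

theorem eq_neg_e_two_of_cross_eq_zero {n : E3} (hn : ‖n‖ = 1) (hc : cross n (e 2) = 0)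
    (hneg : inner ℝ n (e 2) < 0) : n = -e 2 := by
  have h0 : n 1 = 0 := by
    have := congrArg (fun v : E3 => v 0) hc
    simpa [cross_apply_zero, e] using this
  have h1 : n 0 = 0 := by
    have := congrArg (fun v : E3 => v 1) hc
    simpa [cross_apply_one, e] using this
  have h2 : n 2 = -1 := by
    have h3 : n 2 * n 2 = 1 := by
      have := real_inner_self_eq_norm_sq n
      rw [inner_eq_sum, hn, h0, h1] at this
      linarith
    rw [inner_e_right] at hneg
    nlinarith
  ext i
  fin_cases i <;> simp [e, h0, h1, h2]

section Rotation

variable {A : Matrix (Fin 3) (Fin 3) ℝ}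

theorem inner_toOp_toOp (hA : A ∈ Matrix.specialOrthogonalGroup (Fin 3) ℝ) (x y : E3) :
    inner ℝ (toOp A x) (toOp A y) = inner ℝ x y := by
  have h1 : star A * A = 1 := (Matrix.mem_orthogonalGroup_iff' (Fin 3) ℝ).1 hA.1
  have h2 : star (toOp A) * toOp A = 1 := by
    unfold toOp
    rw [← map_star, ← map_mul, h1, map_one]
  rw [← ContinuousLinearMap.adjoint_inner_right, ← ContinuousLinearMap.star_eq_adjoint,
    ← mul_apply_eq_comp, h2, one_apply_eq_self]

/-- The columns of a rotation form an orthonormal basis. -/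
theorem eq_sum_inner_toOp_smul (hA : A ∈ Matrix.specialOrthogonalGroup (Fin 3) ℝ) (v : E3) :
    v = inner ℝ v (toOp A (e 0)) • toOp A (e 0) + inner ℝ v (toOp A (e 1)) • toOp A (e 1) +
      inner ℝ v (toOp A (e 2)) • toOp A (e 2) := by
  have h1 : A * star A = 1 := (Matrix.mem_orthogonalGroup_iff (Fin 3) ℝ).1 hA.1
  have h2 : toOp A * star (toOp A) = 1 := by
    unfold toOp
    rw [← map_star, ← map_mul, h1, map_one]
  obtain ⟨w, rfl⟩ : ∃ w, toOp A w = v := ⟨star (toOp A) v, by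
    rw [← mul_apply_eq_comp, h2, one_apply_eq_self]⟩
  simp only [inner_toOp_toOp hA, inner_e_right, ← map_smul, ← map_add]
  congr 1
  ext i
  fin_cases i <;> simp [e]

end Rotation

/-! ### The rotating frame -/

/-- The matrix of the rotation `exp (θ S)`. -/
def rot (θ : ℝ) : Matrix (Fin 3) (Fin 3) ℝ :=
  !![Real.cos θ, Real.sin θ, 0; -Real.sin θ, Real.cos θ, 0; 0, 0, 1]

section

attribute [local instance] Matrix.linftyOpNormedRing Matrix.linftyOpNormedAlgebra

/-- `exp (x S) rot (-x)` has zero derivative, as `rot x = 1 + sin x S + (1 - cos x) S²` by Rodrigues'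
formula. The norm on matrices only serves to differentiate: `NormedSpace.exp` depends on the
topology alone. -/
theorem exp_smul_S (θ : ℝ) : NormedSpace.exp (θ • S) = rot θ := by
  have hS : S * (S * S) = -S := by
    ext i j
    fin_cases i <;> fin_cases j <;> simp [S, Matrix.mul_apply, Fin.sum_univ_three]
  have hrot_eq : ∀ x, rot (-x) = 1 - Real.sin x • S + (1 - Real.cos x) • (S * S) := by
    intro x
    ext i j
    fin_cases i <;> fin_cases j <;>
      simp [rot, S]
  have hrot : ∀ x, HasDerivAt (fun x => 1 - Real.sin x • S + (1 - Real.cos x) • (S * S))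
      (0 - Real.cos x • S + (0 - -Real.sin x) • (S * S)) x := fun x =>
    ((hasDerivAt_const x _).fun_sub ((Real.hasDerivAt_sin x).smul_const S)).fun_add
      (((hasDerivAt_const x (1 : ℝ)).fun_sub (Real.hasDerivAt_cos x)).smul_const (S * S))
  have h : ∀ x, HasDerivAt (fun x : ℝ => NormedSpace.exp (x • S) * rot (-x)) 0 x := by
    intro x
    simp only [hrot_eq]
    refine ((hasDerivAt_exp_smul_const S x).fun_mul (hrot x)).congr_deriv ?_
    rw [mul_assoc, ← mul_add]
    refine mul_eq_zero_of_right _ ?_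
    simp only [mul_add, mul_sub, mul_smul_comm, hS, mul_one]
    module
  have hconst := is_const_of_deriv_eq_zero (fun x => (h x).differentiableAt)
    (fun x => (h x).deriv) θ 0
  have h0 : rot 0 = 1 := by
    ext i j
    fin_cases i <;> fin_cases j <;> simp [rot]
  have hinv : rot (-θ) * rot θ = 1 := by
    have := Real.sin_sq_add_cos_sq θ
    ext i j
    fin_cases i <;> fin_cases j <;> simp [rot, Matrix.mul_apply, Fin.sum_univ_three] <;> nlinarith
  simp only [zero_smul, NormedSpace.exp_zero, neg_zero, h0, one_mul] at hconst
  calc NormedSpace.exp (θ • S) = NormedSpace.exp (θ • S) * (rot (-θ) * rot θ) := by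
        rw [hinv, mul_one]
    _ = rot θ := by rw [← mul_assoc, hconst, one_mul]

end

theorem Fe_zero (T : ℝ) (R : ℝ → Matrix (Fin 3) (Fin 3) ℝ) (t ω : ℝ) :
    Fe T R 0 t ω = Real.cos (sigma T t * ω) • toOp (R ω) (e 0) -
      Real.sin (sigma T t * ω) • toOp (R ω) (e 1) := by
  have h : toOp (rot (sigma T t * ω)) (e 0) =
      Real.cos (sigma T t * ω) • e 0 - Real.sin (sigma T t * ω) • e 1 := by
    ext i
    fin_cases i <;> simp [toOp, rot, e, Matrix.mulVec, dotProduct]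
  rw [Fe, F, exp_smul_S, toOp, map_mul, mul_apply_eq_comp]
  change toOp _ (toOp _ _) = _
  rw [h, map_sub, map_smul, map_smul]

theorem Fe_one (T : ℝ) (R : ℝ → Matrix (Fin 3) (Fin 3) ℝ) (t ω : ℝ) :
    Fe T R 1 t ω = Real.sin (sigma T t * ω) • toOp (R ω) (e 0) +
      Real.cos (sigma T t * ω) • toOp (R ω) (e 1) := by
  have h : toOp (rot (sigma T t * ω)) (e 1) =
      Real.sin (sigma T t * ω) • e 0 + Real.cos (sigma T t * ω) • e 1 := by
    ext i
    fin_cases i <;> simp [toOp, rot, e, Matrix.mulVec, dotProduct]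
  rw [Fe, F, exp_smul_S, toOp, map_mul, mul_apply_eq_comp]
  change toOp _ (toOp _ _) = _
  rw [h, map_add, map_smul, map_smul]

/-- The sign `ε` equals `1` on `[0, T)`. -/
theorem sigma_eq_self {T t : ℝ} (ht : t ∈ Ico 0 T) : sigma T t = t := by
  have h : ∀ s ∈ uIcc 0 t, eps T s = 1 := by
    intro s hs
    rw [uIcc_of_le ht.1] at hs
    have hT : 0 < T := ht.1.trans_lt ht.2
    have : ⌊s / T⌋ = 0 := Int.floor_eq_zero_iff.2
      ⟨div_nonneg hs.1 hT.le, (div_lt_one hT).2 (hs.2.trans_lt ht.2)⟩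
    simp [eps, this]
  rw [sigma, intervalIntegral.integral_congr h]
  simp

end Geometry

/-! ### Fourier transforms vanishing on an interval -/

section Moments

open scoped FourierTransform

variable {a b T : ℝ}

theorem integrableOn_continuous_smul {φ : ℝ → ℝ} {k : ℝ → ℂ} (hφ : Continuous φ)
    (hk : IntegrableOn k (Ioo a b)) : IntegrableOn (fun x => φ x • k x) (Ioo a b) := by
  obtain ⟨C, hC⟩ := (isCompact_Icc (a := a) (b := b)).exists_bound_of_continuousOn hφ.continuousOn
  refine Integrable.bdd_smul hk C hφ.aestronglyMeasurable ?_
  filter_upwards [ae_restrict_mem measurableSet_Ioo] with x hx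
  exact hC x (Ioo_subset_Icc_self hx)

/-- An integrable function on `(a, b)` all of whose moments vanish is zero. -/
theorem ae_eq_zero_of_moments_eq_zero {k : ℝ → ℂ} (hk : IntegrableOn k (Ioo a b))
    (h : ∀ n : ℕ, ∫ x in Ioo a b, (x : ℂ) ^ n * k x = 0) :
    ∀ᵐ x ∂volume.restrict (Ioo a b), k x = 0 := by
  have hint : ∀ φ : ℝ → ℝ, Continuous φ → IntegrableOn (fun x => φ x • k x) (Ioo a b) :=
    fun φ hφ => integrableOn_continuous_smul hφ hk
  have hpoly : ∀ P : Polynomial ℝ, ∫ x in Ioo a b, P.eval x • k x = 0 := by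
    intro P
    induction P using Polynomial.induction_on' with
    | add P Q hP hQ =>
      simp only [Polynomial.eval_add, add_smul]
      rw [integral_add (hint _ P.continuous) (hint _ Q.continuous), hP, hQ, add_zero]
    | monomial n c =>
      have : ∀ x : ℝ, (Polynomial.monomial n c).eval x • k x = (c : ℂ) * ((x : ℂ) ^ n * k x) := by
        intro x
        simp [Complex.real_smul, mul_assoc]
      simp only [this]
      rw [integral_const_mul, h n, mul_zero]
  have hcont : ∀ φ : ℝ → ℝ, Continuous φ → ∫ x in Ioo a b, φ x • k x = 0 := by
    intro φ hφ
    by_contra hne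
    set M := ∫ x in Ioo a b, ‖k x‖ with hM
    have hM0 : 0 ≤ M := by positivity
    obtain ⟨P, hP⟩ := exists_polynomial_near_of_continuousOn a b φ hφ.continuousOn
      (‖∫ x in Ioo a b, φ x • k x‖ / (M + 1)) (by positivity)
    have h1 : ‖∫ x in Ioo a b, φ x • k x‖ ≤ ‖∫ x in Ioo a b, φ x • k x‖ / (M + 1) * M := by
      calc ‖∫ x in Ioo a b, φ x • k x‖ = ‖∫ x in Ioo a b, (φ x • k x - P.eval x • k x)‖ := by
            rw [integral_sub (hint φ hφ) (hint _ P.continuous), hpoly, sub_zero]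
        _ ≤ ∫ x in Ioo a b, ‖∫ x in Ioo a b, φ x • k x‖ / (M + 1) * ‖k x‖ := by
            refine norm_integral_le_of_norm_le (hk.norm.const_mul _) ?_
            filter_upwards [ae_restrict_mem measurableSet_Ioo] with x hx
            rw [← sub_smul, norm_smul, norm_sub_rev]
            gcongr
            exact (hP x (Ioo_subset_Icc_self hx)).le
        _ = _ := by rw [integral_const_mul]
    have h2 : 0 < ‖∫ x in Ioo a b, φ x • k x‖ := norm_pos_iff.2 hne
    rw [div_mul_eq_mul_div, le_div_iff₀ (by positivity)] at h1
    nlinarith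
  rw [ae_restrict_iff' measurableSet_Ioo]
  refine isOpen_Ioo.ae_eq_zero_of_integral_contDiff_smul_eq_zero hk.locallyIntegrableOn
    fun φ hφ _ hφs => ?_
  rw [← setIntegral_eq_integral_of_forall_compl_eq_zero (s := Ioo a b) (fun x hx => by
    rw [image_eq_zero_of_notMem_tsupport fun h' => hx (hφs h'), zero_smul])]
  exact hcont φ hφ.continuous

/-- The Fourier transform of a nonzero integrable function on `(a, b)` vanishes on no interval: its
derivatives at an interior point `w` of the interval are the moments of `exp(-2πi x w) f(x)`. -/
theorem ae_eq_zero_of_integral_cexp_mul_eq_zero (hT : 0 < T) {f : ℝ → ℂ}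
    (hf : IntegrableOn f (Ioo a b))
    (h : ∀ s ∈ Ioo 0 T, ∫ x in Ioo a b, Complex.exp (s * x * Complex.I) * f x = 0) :
    ∀ᵐ x ∂volume.restrict (Ioo a b), f x = 0 := by
  have hind : ∀ n : ℕ, Integrable (fun x : ℝ => x ^ n • (Ioo a b).indicator f x) := by
    intro n
    have : (fun x : ℝ => x ^ n • (Ioo a b).indicator f x)
        = (Ioo a b).indicator (fun x => x ^ n • f x) := by
      ext x
      by_cases hx : x ∈ Ioo a b <;> simp [hx]
    rw [this, integrable_indicator_iff measurableSet_Ioo]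
    exact integrableOn_continuous_smul (continuous_pow n) hf
  have hzero : ∀ w ∈ Ioo (-(T / (2 * Real.pi))) 0, 𝓕 ((Ioo a b).indicator f) w = 0 := by
    intro w hw
    have hpi := Real.pi_pos
    have hs : -(2 * Real.pi * w) ∈ Ioo 0 T := by
      have h1 := hw.1
      have h2 := hw.2
      have h3 : 2 * Real.pi * (T / (2 * Real.pi)) = T := by field_simp
      constructor <;> nlinarith
    rw [Real.fourier_real_eq_integral_exp_smul, ← h _ hs, ← integral_indicator measurableSet_Ioo]
    congr 1
    ext x
    by_cases hx : x ∈ Ioo a b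
    · simp only [hx, indicator_of_mem, smul_eq_mul]
      push_cast
      ring_nf
    · simp [hx]
  have hpos : 0 < T / (2 * Real.pi) := by positivity
  set w := -(T / (2 * Real.pi)) / 2 with hw
  have hwm : w ∈ Ioo (-(T / (2 * Real.pi))) 0 := ⟨by rw [hw]; linarith, by rw [hw]; linarith⟩
  have hmom : ∀ n : ℕ, ∫ x in Ioo a b, (x : ℂ) ^ n *
      (Complex.exp ((-2 * Real.pi * x * w : ℝ) * Complex.I) * f x) = 0 := by
    intro n
    have h1 := congrFun (Real.iteratedDeriv_fourier (f := (Ioo a b).indicator f) (N := ⊤) (n := n)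
      (fun n _ => hind n) le_top) w
    have h2 : iteratedDeriv n (𝓕 ((Ioo a b).indicator f)) w = 0 := by
      have : 𝓕 ((Ioo a b).indicator f) =ᶠ[𝓝 w] fun _ => 0 := by
        filter_upwards [Ioo_mem_nhds hwm.1 hwm.2] with z hz using hzero z hz
      rw [this.iteratedDeriv_eq]
      simp
    rw [h2, Real.fourier_real_eq_integral_exp_smul] at h1
    have h3 : (-2 * Real.pi * Complex.I : ℂ) ^ n ≠ 0 := by
      refine pow_ne_zero _ ?_
      simp [Real.pi_ne_zero, Complex.I_ne_zero]
    refine (mul_eq_zero_iff_left h3).1 ?_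
    rw [← integral_const_mul, h1, ← integral_indicator measurableSet_Ioo]
    congr 1
    ext x
    by_cases hx : x ∈ Ioo a b
    · simp only [hx, indicator_of_mem, smul_eq_mul]
      ring
    · simp [hx]
  have hki : IntegrableOn
      (fun x : ℝ => Complex.exp ((-2 * Real.pi * x * w : ℝ) * Complex.I) * f x) (Ioo a b) := by
    refine Integrable.bdd_mul (c := 1) hf (by fun_prop) (ae_of_all _ fun x => ?_)
    rw [Complex.norm_exp_ofReal_mul_I]
  filter_upwards [ae_eq_zero_of_moments_eq_zero hki hmom] with x hx
  exact (mul_eq_zero.1 hx).resolve_left (Complex.exp_ne_zero _)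

/-- If the distribution `q - p'` on the real line, where `p` and `q` are extended by zero outside
`(a, b)`, has a Fourier transform that vanishes on an interval, then it is zero: `p` is a primitive
of `q` that vanishes at `a` and at `b`. -/
theorem exists_isPrimitive_of_integral_cexp_mul_eq_zero (hab : a < b) (hT : 0 < T) {p q : ℝ → ℂ}
    (hp : IntegrableOn p (Ioo a b)) (hq : IntegrableOn q (Ioo a b))
    (h : ∀ s ∈ Ico 0 T,
      ∫ x in Ioo a b, Complex.exp (s * x * Complex.I) * (q x + s * Complex.I * p x) = 0) :
    ∃ Q, IsPrimitive a b Q q ∧ Q a = 0 ∧ Q b = 0 ∧ p =ᵐ[volume.restrict (Ioo a b)] Q := by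
  set Q : ℝ → ℂ := fun x => ∫ s in a..x, q s with hQ
  have hQp : IsPrimitive a b Q q := ⟨hq, fun x _ => by simp [hQ]⟩
  have hQa : Q a = 0 := by simp [hQ]
  -- The case `s = 0` of the hypothesis.
  have hQb : Q b = 0 := by
    have := h 0 ⟨le_rfl, hT⟩
    simpa [hQ, intervalIntegral_eq_setIntegral_Ioo hab.le] using this
  have hQi : IntegrableOn Q (Ioo a b) :=
    (hQp.continuousOn hab.le).integrableOn_Icc.mono_set Ioo_subset_Icc_self
  refine ⟨Q, hQp, hQa, hQb, ?_⟩
  have hbd : ∀ (s : ℝ) {k : ℝ → ℂ}, IntegrableOn k (Ioo a b) →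
      IntegrableOn (fun x : ℝ => Complex.exp (s * x * Complex.I) * k x) (Ioo a b) := by
    intro s k hk
    refine Integrable.bdd_mul (c := 1) hk (by fun_prop) (ae_of_all _ fun x => ?_)
    rw [← Complex.ofReal_mul, Complex.norm_exp_ofReal_mul_I]
  have hz : ∀ᵐ x ∂volume.restrict (Ioo a b), p x - Q x = 0 := by
    refine ae_eq_zero_of_integral_cexp_mul_eq_zero hT (hp.sub hQi) fun s hs => ?_
    have hE : IsPrimitive a b (fun x : ℝ => Complex.exp (s * x * Complex.I))
        (fun x : ℝ => Complex.exp (s * x * Complex.I) * (s * Complex.I)) := by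
      refine IsPrimitive.of_hasDerivAt (fun x => ?_) (by fun_prop)
      have h1 : HasDerivAt (fun x : ℝ => (s : ℂ) * x * Complex.I) (s * Complex.I) x := by
        simpa using ((Complex.ofRealCLM.hasDerivAt (x := x)).const_mul (s : ℂ)).mul_const Complex.I
      exact h1.cexp
    -- Integration by parts turns `∫ exp(isx) q` into `-is ∫ exp(isx) Q`, without boundary terms.
    have h2 := (hE.bilinear (ContinuousLinearMap.mul ℝ ℂ) hQp hab.le).integral_eq_sub hab.le
    simp only [ContinuousLinearMap.mul_apply', hQa, hQb, mul_zero, sub_zero] at h2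
    have i1 := (hbd s hQi).const_mul (s * Complex.I)
    have i2 := hbd s hq
    have i3 := (hbd s hp).const_mul (s * Complex.I)
    have e1 : ∫ x in Ioo a b, Complex.exp (s * x * Complex.I) * (s * Complex.I) * Q x +
        Complex.exp (s * x * Complex.I) * q x =
        s * Complex.I * (∫ x in Ioo a b, Complex.exp (s * x * Complex.I) * Q x) +
        ∫ x in Ioo a b, Complex.exp (s * x * Complex.I) * q x := by
      rw [← integral_const_mul, ← integral_add i1 i2]
      exact integral_congr_ae (ae_of_all _ fun x => by ring)
    have e2 : ∫ x in Ioo a b, Complex.exp (s * x * Complex.I) * (q x + s * Complex.I * p x) =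
        (∫ x in Ioo a b, Complex.exp (s * x * Complex.I) * q x) +
        s * Complex.I * ∫ x in Ioo a b, Complex.exp (s * x * Complex.I) * p x := by
      rw [← integral_const_mul, ← integral_add i2 i3]
      exact integral_congr_ae (ae_of_all _ fun x => by ring)
    rw [e1] at h2
    have h3 := h s ⟨hs.1.le, hs.2⟩
    rw [e2] at h3
    simp only [mul_sub]
    rw [integral_sub (hbd s hp) (hbd s hQi)]
    have h4 : (s * Complex.I : ℂ) ≠ 0 := by
      simp [hs.1.ne', Complex.I_ne_zero]
    refine (mul_eq_zero_iff_left h4).1 ?_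
    linear_combination h3 - h2
  filter_upwards [hz] with x hx
  exact sub_eq_zero.1 hx

end Moments

/-! ### The frame and the fields `F eᵢ` in `H¹` -/

section ClosedLoop

variable {a b T : ℝ} {R : ℝ → Matrix (Fin 3) (Fin 3) ℝ}

theorem hasH1Deriv_column (hab : a < b) (hR : MemH1SO3 a b R) (i : Fin 3) :
    HasH1Deriv a b (fun ω => toOp (R ω) (e i))
      (fun ω => weakDeriv a b (fun ω => toOp (R ω)) ω (e i)) :=
  (hR.1.hasH1Deriv hab).clm_comp (ContinuousLinearMap.apply ℝ E3 (e i)) hab.le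

theorem hasH1Deriv_cos_mul (s : ℝ) :
    HasH1Deriv a b (fun ω => Real.cos (s * ω)) (fun ω => -Real.sin (s * ω) * s) := by
  refine HasH1Deriv.of_hasDerivAt (fun x => ?_) (by fun_prop)
  simpa using (((hasDerivAt_id x).const_mul s).cos)

theorem hasH1Deriv_sin_mul (s : ℝ) :
    HasH1Deriv a b (fun ω => Real.sin (s * ω)) (fun ω => Real.cos (s * ω) * s) := by
  refine HasH1Deriv.of_hasDerivAt (fun x => ?_) (by fun_prop)
  simpa using (((hasDerivAt_id x).const_mul s).sin)

theorem HasH1Deriv.smul {E : Type*} [NormedAddCommGroup E] [NormedSpace ℝ E] [CompleteSpace E]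
    {φ φ' : ℝ → ℝ} {f f' : ℝ → E} (hφ : HasH1Deriv a b φ φ') (hf : HasH1Deriv a b f f')
    (hab : a ≤ b) : HasH1Deriv a b (fun x => φ x • f x) (fun x => φ' x • f x + φ x • f' x) :=
  hφ.bilinear (ContinuousLinearMap.lsmul ℝ ℝ) hf hab

theorem HasH1Deriv.inner {E : Type*} [NormedAddCommGroup E] [InnerProductSpace ℝ E]
    [CompleteSpace E] {f f' g g' : ℝ → E} (hf : HasH1Deriv a b f f') (hg : HasH1Deriv a b g g')
    (hab : a ≤ b) : HasH1Deriv a b (fun x => inner ℝ (f x) (g x))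
      (fun x => inner ℝ (f' x) (g x) + inner ℝ (f x) (g' x)) :=
  hf.bilinear (innerSL ℝ) hg hab

theorem HasH1Deriv.cross {f f' g g' : ℝ → E3} (hf : HasH1Deriv a b f f')
    (hg : HasH1Deriv a b g g') (hab : a ≤ b) :
    HasH1Deriv a b (fun x => BlochEnsemble.cross (f x) (g x))
      (fun x => BlochEnsemble.cross (f' x) (g x) + BlochEnsemble.cross (f x) (g' x)) :=
  hf.bilinear crossL hg hab

theorem hasH1Deriv_Fe_zero (hab : a < b) (hR : MemH1SO3 a b R) (t : ℝ) :
    HasH1Deriv a b (Fe T R 0 t) (fun ω =>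
      ((-Real.sin (sigma T t * ω) * sigma T t) • toOp (R ω) (e 0) +
        Real.cos (sigma T t * ω) • weakDeriv a b (fun ω => toOp (R ω)) ω (e 0)) -
      ((Real.cos (sigma T t * ω) * sigma T t) • toOp (R ω) (e 1) +
        Real.sin (sigma T t * ω) • weakDeriv a b (fun ω => toOp (R ω)) ω (e 1))) :=
  (((hasH1Deriv_cos_mul (sigma T t)).smul (hasH1Deriv_column hab hR 0) hab.le).sub
    ((hasH1Deriv_sin_mul (sigma T t)).smul (hasH1Deriv_column hab hR 1) hab.le) hab.le).congr
    hab.le (fun ω _ => (Fe_zero T R t ω).symm) (ae_eq_refl _)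

theorem hasH1Deriv_Fe_one (hab : a < b) (hR : MemH1SO3 a b R) (t : ℝ) :
    HasH1Deriv a b (Fe T R 1 t) (fun ω =>
      ((Real.cos (sigma T t * ω) * sigma T t) • toOp (R ω) (e 0) +
        Real.sin (sigma T t * ω) • weakDeriv a b (fun ω => toOp (R ω)) ω (e 0)) +
      ((-Real.sin (sigma T t * ω) * sigma T t) • toOp (R ω) (e 1) +
        Real.cos (sigma T t * ω) • weakDeriv a b (fun ω => toOp (R ω)) ω (e 1))) :=
  (((hasH1Deriv_sin_mul (sigma T t)).smul (hasH1Deriv_column hab hR 0) hab.le).add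
    ((hasH1Deriv_cos_mul (sigma T t)).smul (hasH1Deriv_column hab hR 1) hab.le) hab.le).congr
    hab.le (fun ω _ => (Fe_one T R t ω).symm) (ae_eq_refl _)

/-! ### The Lyapunov functional along the closed-loop system -/

theorem integrable_feedback_integrand (hab : a < b) {n f : ℝ → E3} (hn : MemH1 a b n)
    (hf : MemH1 a b f) : IntegrableOn (fun ω => inner ℝ (weakDeriv a b n ω)
      (cross (weakDeriv a b f ω) (n ω)) + inner ℝ (e 2) (cross (f ω) (n ω))) (Ioo a b) := by
  have cn := (hn.hasH1Deriv hab).continuousOn hab.le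
  exact (integrable_inner (memLp_weakDeriv n)
    (memLp_bilinear_left crossL (memLp_weakDeriv f) cn)).add
    (integrable_inner (memLp_const _)
      (memLp_bilinear_left crossL ((hf.hasH1Deriv hab).memLp_self hab.le) cn))

/-- Along a solution, `dℒ/dt = u₁ H₁ + u₂ H₂ = -(H₁² + H₂²)`. -/
theorem hasDerivWithinAt_lyapunov_of_isSolution (hab : a < b) (hR : MemH1SO3 a b R)
    {N V : ℝ → ℝ → E3} (hNV : IsC1H1 a b N V) (hV : ∀ t, 0 ≤ t → ∀ ω ∈ Icc a b,
      V t ω = u a b T R 0 t (N t) • cross (Fe T R 0 t ω) (N t ω) +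
        u a b T R 1 t (N t) • cross (Fe T R 1 t ω) (N t ω)) {t : ℝ} (ht : 0 ≤ t) :
    HasDerivWithinAt (fun s => lyapunov a b (N s))
      (-(H a b T R 0 t (N t) ^ 2 + H a b T R 1 t (N t) ^ 2)) (Ici 0) t := by
  refine (hNV.hasDerivWithinAt_lyapunov hab ht).congr_deriv ?_
  have hN := (hNV.mem t ht).hasH1Deriv hab
  have h0 := hasH1Deriv_Fe_zero (T := T) hab hR t
  have h1 := hasH1Deriv_Fe_one (T := T) hab hR t
  have m0 := h0.toIsPrimitive.memH1 hab h0.memLp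
  have m1 := h1.toIsPrimitive.memH1 hab h1.memLp
  have hV' := (((((m0.hasH1Deriv hab).cross hN hab.le).const_smul (u a b T R 0 t (N t))).add
    (((m1.hasH1Deriv hab).cross hN hab.le).const_smul (u a b T R 1 t (N t))) hab.le).congr hab.le
    (fun ω hω => (hV t ht ω hω).symm) (ae_eq_refl _)).weakDeriv_ae_eq hab
  calc _ = ∫ ω in Ioo a b, (u a b T R 0 t (N t) * (inner ℝ (weakDeriv a b (N t) ω)
          (cross (weakDeriv a b (Fe T R 0 t) ω) (N t ω)) +
          inner ℝ (e 2) (cross (Fe T R 0 t ω) (N t ω))) +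
        u a b T R 1 t (N t) * (inner ℝ (weakDeriv a b (N t) ω)
          (cross (weakDeriv a b (Fe T R 1 t) ω) (N t ω)) +
          inner ℝ (e 2) (cross (Fe T R 1 t ω) (N t ω)))) := by
        refine integral_congr_ae ?_
        filter_upwards [hV', ae_restrict_mem measurableSet_Ioo] with ω h2 hω
        rw [h2, hV t ht ω (Ioo_subset_Icc_self hω)]
        simp only [inner_add_right, inner_smul_right, inner_cross_self_right]
        ring
    _ = u a b T R 0 t (N t) * H a b T R 0 t (N t) + u a b T R 1 t (N t) * H a b T R 1 t (N t) := by
        rw [integral_add ((integrable_feedback_integrand hab (hNV.mem t ht) m0).const_mul _)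
          ((integrable_feedback_integrand hab (hNV.mem t ht) m1).const_mul _),
          integral_const_mul, integral_const_mul]
        rfl
    _ = _ := by
        unfold u
        ring

theorem eq_of_hasDerivWithinAt_zero {E : Type*} [NormedAddCommGroup E] [NormedSpace ℝ E]
    {f : ℝ → E} (h : ∀ t, 0 ≤ t → HasDerivWithinAt f 0 (Ici 0) t) {t : ℝ} (ht : 0 ≤ t) :
    f t = f 0 :=
  constant_of_has_deriv_right_zero (a := 0) (b := t)
    (fun s hs => ((h s hs.1).continuousWithinAt).mono Icc_subset_Ici_self)
    (fun s hs => (h s hs.1).mono (Ici_subset_Ici.2 hs.1)) t (right_mem_Icc.2 ht)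

/-- The closed-loop system moves each `N(t, ω)` on a sphere. -/
theorem norm_eq_of_isSolution (hab : a < b) {N V : ℝ → ℝ → E3} (hNV : IsC1H1 a b N V)
    (hV : ∀ t, 0 ≤ t → ∀ ω ∈ Icc a b,
      V t ω = u a b T R 0 t (N t) • cross (Fe T R 0 t ω) (N t ω) +
        u a b T R 1 t (N t) • cross (Fe T R 1 t ω) (N t ω)) {t : ℝ} (ht : 0 ≤ t) {ω : ℝ}
    (hω : ω ∈ Icc a b) : ‖N t ω‖ = ‖N 0 ω‖ := by
  have h := eq_of_hasDerivWithinAt_zero (f := fun s => ‖N s ω‖ ^ 2) (fun s hs => by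
    refine (hNV.hasDerivWithinAt_apply hab hs hω).norm_sq.congr_deriv ?_
    rw [hV s hs ω hω]
    simp [inner_add_right, inner_smul_right, inner_cross_self_right]) ht
  exact (pow_left_inj₀ (norm_nonneg _) (norm_nonneg _) two_ne_zero).1 h

theorem lyapunov_nonneg {n : ℝ → E3} (hn : ∀ ω ∈ Icc a b, ‖n ω‖ = 1) : 0 ≤ lyapunov a b n := by
  refine setIntegral_nonneg measurableSet_Ioo fun ω hω => ?_
  have h1 : |inner ℝ (n ω) (e 2)| ≤ 1 := by
    refine (abs_real_inner_le_norm _ _).trans ?_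
    simp [hn ω (Ioo_subset_Icc_self hω), e]
  have h2 := (abs_le.1 h1).1
  have h3 : 0 ≤ ‖weakDeriv a b n ω‖ ^ 2 := by positivity
  linarith

theorem lyapunov_eq_zero (hab : a < b) {n : ℝ → E3} (hn : ∀ ω ∈ Icc a b, n ω = -e 2) :
    lyapunov a b n = 0 := by
  have h := ((HasH1Deriv.const (a := a) (b := b) (-e 2)).congr hab.le
    (fun ω hω => (hn ω hω).symm) (ae_eq_refl _)).weakDeriv_ae_eq hab
  refine integral_eq_zero_of_ae ?_
  filter_upwards [h, ae_restrict_mem measurableSet_Ioo] with ω h1 hω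
  rw [h1, hn ω (Ioo_subset_Icc_self hω)]
  simp [e]

/-! ### Test functions for the stationary equation -/

/-- The integrand `⟨(φ R eⱼ)', n ∧ n'⟩ + ⟨φ R eⱼ, n ∧ e₃⟩` of the weak form of the equation
`(n ∧ n')' = n ∧ e₃` tested against `φ R eⱼ`; `φ'` stands for the derivative of `φ`. -/
def columnTestIntegrand (a b : ℝ) (R : ℝ → Matrix (Fin 3) (Fin 3) ℝ) (n : ℝ → E3) (j : Fin 3)
    (φ φ' : ℝ → ℝ) (ω : ℝ) : ℝ :=
  φ' ω * inner ℝ (toOp (R ω) (e j)) (cross (n ω) (weakDeriv a b n ω)) +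
    φ ω * (inner ℝ (weakDeriv a b (fun ω => toOp (R ω)) ω (e j))
      (cross (n ω) (weakDeriv a b n ω)) + inner ℝ (toOp (R ω) (e j)) (cross (n ω) (e 2)))

/-- If both feedbacks vanish on `[0, T)` at a state `n`, then the equation
`(n ∧ n')' = n ∧ e₃`, with `n ∧ n' = 0` at the endpoints, holds when tested against
`φ R e₁` and `φ R e₂`. -/
theorem integral_test_column_eq_zero (hab : a < b) (hT : 0 < T) (hR : MemH1SO3 a b R) {n : ℝ → E3}
    (hn : MemH1 a b n) (h0 : ∀ t ∈ Ico 0 T, H a b T R 0 t n = 0)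
    (h1 : ∀ t ∈ Ico 0 T, H a b T R 1 t n = 0) {φ φ' : ℝ → ℝ} (hφ : IsPrimitive a b φ φ')
    {j : Fin 3} (hj : j ≠ 2) :
    IntegrableOn (columnTestIntegrand a b R n j φ φ') (Ioo a b) ∧
      ∫ ω in Ioo a b, columnTestIntegrand a b R n j φ φ' ω = 0 := by
  have cn := (hn.hasH1Deriv hab).continuousOn hab.le
  have hX := fun j => hasH1Deriv_column hab hR j
  have hJ : MemLp (fun ω => cross (n ω) (weakDeriv a b n ω)) 2 (volume.restrict (Ioo a b)) :=
    memLp_bilinear_right crossL cn (memLp_weakDeriv n)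
  have hK : MemLp (fun ω => cross (n ω) (e 2)) 2 (volume.restrict (Ioo a b)) :=
    memLp_bilinear_left crossL ((hn.hasH1Deriv hab).memLp_self hab.le) continuousOn_const
  set p : Fin 3 → ℝ → ℝ :=
    fun j ω => inner ℝ (toOp (R ω) (e j)) (cross (n ω) (weakDeriv a b n ω)) with hp
  set q : Fin 3 → ℝ → ℝ := fun j ω => inner ℝ (weakDeriv a b (fun ω => toOp (R ω)) ω (e j))
    (cross (n ω) (weakDeriv a b n ω)) + inner ℝ (toOp (R ω) (e j)) (cross (n ω) (e 2)) with hq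
  have ip : ∀ j, IntegrableOn (p j) (Ioo a b) := fun j =>
    integrable_inner ((hX j).memLp_self hab.le) hJ
  have iq : ∀ j, IntegrableOn (q j) (Ioo a b) := fun j =>
    (integrable_inner (hX j).memLp hJ).add (integrable_inner ((hX j).memLp_self hab.le) hK)
  have ipc : IntegrableOn (fun ω => (p 0 ω : ℂ) + p 1 ω * Complex.I) (Ioo a b) :=
    (ip 0).ofReal.add ((ip 1).ofReal.mul_const _)
  have iqc : IntegrableOn (fun ω => (q 0 ω : ℂ) + q 1 ω * Complex.I) (Ioo a b) :=
    (iq 0).ofReal.add ((iq 1).ofReal.mul_const _)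
  obtain ⟨Q, hQ, hQa, hQb, hpQ⟩ := exists_isPrimitive_of_integral_cexp_mul_eq_zero hab hT ipc iqc (by
    intro s hs
    have hσ := sigma_eq_self hs
    have iz : IntegrableOn (fun x : ℝ => Complex.exp (s * x * Complex.I) *
        ((q 0 x : ℂ) + q 1 x * Complex.I + s * Complex.I * ((p 0 x : ℂ) + p 1 x * Complex.I)))
        (Ioo a b) := by
      refine Integrable.bdd_mul (c := 1) (iqc.add (ipc.const_mul _)) (by fun_prop)
        (ae_of_all _ fun x => ?_)
      rw [← Complex.ofReal_mul, Complex.norm_exp_ofReal_mul_I]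
    have hcos : ∀ x : ℝ, (Complex.exp (s * x * Complex.I)).re = Real.cos (s * x) := fun x => by
      rw [← Complex.ofReal_mul, Complex.exp_ofReal_mul_I_re]
    have hsin : ∀ x : ℝ, (Complex.exp (s * x * Complex.I)).im = Real.sin (s * x) := fun x => by
      rw [← Complex.ofReal_mul, Complex.exp_ofReal_mul_I_im]
    have e0 := h0 s hs
    have e1 := h1 s hs
    rw [H] at e0 e1
    have w0 := (hasH1Deriv_Fe_zero (T := T) hab hR s).weakDeriv_ae_eq hab
    have w1 := (hasH1Deriv_Fe_one (T := T) hab hR s).weakDeriv_ae_eq hab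
    rw [hσ] at w0 w1
    -- The real and imaginary parts of the complex integral are the two feedback integrals.
    have r0 : ∫ x in Ioo a b, RCLike.re (Complex.exp (s * x * Complex.I) *
        ((q 0 x : ℂ) + q 1 x * Complex.I + s * Complex.I * ((p 0 x : ℂ) + p 1 x * Complex.I)))
        = 0 := by
      rw [← e0]
      refine integral_congr_ae ?_
      filter_upwards [w0] with x hx
      rw [hx, Fe_zero, hσ, inner_cross_rotate, inner_cross_rotate _ _ (e 2)]
      simp only [inner_sub_left, inner_add_left, inner_smul_left, hp, hq]
      simp [hcos, hsin]
      ring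
    have r1 : ∫ x in Ioo a b, RCLike.im (Complex.exp (s * x * Complex.I) *
        ((q 0 x : ℂ) + q 1 x * Complex.I + s * Complex.I * ((p 0 x : ℂ) + p 1 x * Complex.I)))
        = 0 := by
      rw [← e1]
      refine integral_congr_ae ?_
      filter_upwards [w1] with x hx
      rw [hx, Fe_one, hσ, inner_cross_rotate, inner_cross_rotate _ _ (e 2)]
      simp only [inner_add_left, inner_smul_left, hp, hq]
      simp [hcos, hsin]
      ring
    rw [← integral_re_add_im iz, r0, r1]
    simp)
  -- `φ Q` vanishes at both endpoints, so its derivative `φ' Q + φ q`, where `Q = p`, integrates to `0`.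
  have hprod := hφ.bilinear (ContinuousLinearMap.lsmul ℝ ℝ) hQ hab.le
  have hz := hprod.integral_eq_sub hab.le
  have hi := hprod.integrable
  simp only [ContinuousLinearMap.lsmul_apply, hQa, hQb, smul_zero, sub_zero] at hz hi
  have hae : (fun x => φ' x • Q x + φ x • ((q 0 x : ℂ) + q 1 x * Complex.I))
      =ᵐ[volume.restrict (Ioo a b)] fun x => ((φ' x * p 0 x + φ x * q 0 x : ℝ) : ℂ) +
        ((φ' x * p 1 x + φ x * q 1 x : ℝ) : ℂ) * Complex.I := by
    filter_upwards [hpQ] with x hx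
    rw [← hx]
    simp only [Complex.real_smul]
    push_cast
    ring
  have hi' := Integrable.congr hi hae
  rw [integral_congr_ae hae] at hz
  have hre := hi'.re
  have him := hi'.im
  have hzz := integral_re_add_im hi'
  rw [hz] at hzz
  have hz0 := congrArg Complex.re hzz
  have hz1 := congrArg Complex.im hzz
  simp at hre him hz0 hz1
  fin_cases j
  · exact ⟨hre, hz0⟩
  · exact ⟨him, hz1⟩
  · exact absurd rfl hj

end ClosedLoop

/-! ### States at which the feedbacks vanish -/

section StationaryStates

variable {a b T : ℝ} {R : ℝ → Matrix (Fin 3) (Fin 3) ℝ}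

theorem eqOn_Icc_of_ae_eq {E : Type*} [NormedAddCommGroup E] (hab : a < b) {f g : ℝ → E}
    (hf : ContinuousOn f (Icc a b)) (hg : ContinuousOn g (Icc a b))
    (h : f =ᵐ[volume.restrict (Ioo a b)] g) : EqOn f g (Icc a b) :=
  (Measure.eqOn_open_of_ae_eq h isOpen_Ioo (hf.mono Ioo_subset_Icc_self)
    (hg.mono Ioo_subset_Icc_self)).of_subset_closure hf hg Ioo_subset_Icc_self
    (closure_Ioo hab.ne).ge

theorem inner_weakDeriv_self_ae_eq_zero (hab : a < b) {n : ℝ → E3} (hn : MemH1Sphere a b n) :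
    ∀ᵐ ω ∂volume.restrict (Ioo a b), inner ℝ (n ω) (weakDeriv a b n ω) = 0 := by
  have h := hn.1.hasH1Deriv hab
  have h1 : HasH1Deriv a b (fun _ => (1 : ℝ)) _ := (h.inner h hab.le).congr hab.le
    (fun ω hω => by simp [hn.2 ω hω]) (ae_eq_refl _)
  filter_upwards [h1.ae_unique (IsPrimitive.const 1) hab.le] with ω hω
  rw [real_inner_comm (n ω)] at hω
  linarith

/-- A function of `H¹` decomposes in the frame `(R e₁, R e₂, n)`, with coefficients in `H¹`, as soon
as `n` is nowhere orthogonal to `R e₃`. -/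
theorem exists_frame_decomposition (hab : a < b) (hR : MemH1SO3 a b R) {n n' k k' : ℝ → E3}
    (hn : HasH1Deriv a b n n') (hk : HasH1Deriv a b k k')
    (hd : ∀ ω ∈ Icc a b, inner ℝ (n ω) (toOp (R ω) (e 2)) ≠ 0) :
    ∃ φ₁ φ₁' φ₂ φ₂' φ₃ φ₃' : ℝ → ℝ, HasH1Deriv a b φ₁ φ₁' ∧ HasH1Deriv a b φ₂ φ₂' ∧
      HasH1Deriv a b φ₃ φ₃' ∧ ∀ ω ∈ Icc a b,
        k ω = φ₁ ω • toOp (R ω) (e 0) + φ₂ ω • toOp (R ω) (e 1) + φ₃ ω • n ω := by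
  have hX := fun j => hasH1Deriv_column hab hR j
  -- The coefficient along `n` cancels the component of `k` along `R e₃`.
  have h3 := (hk.inner (hX 2) hab.le).smul ((hn.inner (hX 2) hab.le).inv hab.le hd) hab.le
  have hv := hk.sub (h3.smul hn hab.le) hab.le
  refine ⟨_, _, _, _, _, _, hv.inner (hX 0) hab.le, hv.inner (hX 1) hab.le, h3, fun ω hω => ?_⟩
  set v := k ω - (inner ℝ (k ω) (toOp (R ω) (e 2)) • (inner ℝ (n ω) (toOp (R ω) (e 2)))⁻¹) • n ω
    with hv'
  have h0 : inner ℝ v (toOp (R ω) (e 2)) = 0 := by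
    have := hd ω hω
    rw [hv', inner_sub_left, real_inner_smul_left, smul_eq_mul]
    field_simp
    ring
  have h1 := eq_sum_inner_toOp_smul (hR.2 ω hω) v
  rw [h0, zero_smul, add_zero] at h1
  rw [← h1, hv']
  abel

/-- A state in the lower hemisphere, nowhere orthogonal to `R e₃`, at which both feedbacks vanish
during `[0, T)` is the south pole. -/
theorem eq_neg_e_two_of_feedback_eq_zero (hab : a < b) (hT : 0 < T) (hR : MemH1SO3 a b R)
    {n : ℝ → E3} (hn : MemH1Sphere a b n) (h0 : ∀ t ∈ Ico 0 T, H a b T R 0 t n = 0)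
    (h1 : ∀ t ∈ Ico 0 T, H a b T R 1 t n = 0)
    (hneg : ∀ ω ∈ Icc a b, inner ℝ (n ω) (e 2) < 0)
    (hd : ∀ ω ∈ Icc a b, inner ℝ (n ω) (toOp (R ω) (e 2)) ≠ 0) :
    ∀ ω ∈ Icc a b, n ω = -e 2 := by
  have hn' := hn.1.hasH1Deriv hab
  have hK : HasH1Deriv a b (fun ω => cross (n ω) (e 2)) _ :=
    hn'.cross (HasH1Deriv.const (e 2)) hab.le
  have hX := fun j => hasH1Deriv_column hab hR j
  obtain ⟨φ₁, φ₁', φ₂, φ₂', φ₃, φ₃', hφ₁, hφ₂, hφ₃, hdec⟩ :=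
    exists_frame_decomposition hab hR hn' hK hd
  have hsum : HasH1Deriv a b (fun ω => cross (n ω) (e 2)) _ :=
    (((hφ₁.smul (hX 0) hab.le).add (hφ₂.smul (hX 1) hab.le) hab.le).add
      (hφ₃.smul hn' hab.le) hab.le).congr hab.le (fun ω hω => (hdec ω hω).symm) (ae_eq_refl _)
  obtain ⟨i1, z1⟩ := integral_test_column_eq_zero hab hT hR hn.1 h0 h1 hφ₁.toIsPrimitive
    (j := 0) (by decide)
  obtain ⟨i2, z2⟩ := integral_test_column_eq_zero hab hT hR hn.1 h0 h1 hφ₂.toIsPrimitive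
    (j := 1) (by decide)
  -- Testing the stationary equation against `n ∧ e₃` itself.
  have hae : (fun ω => columnTestIntegrand a b R n 0 φ₁ φ₁' ω +
      columnTestIntegrand a b R n 1 φ₂ φ₂' ω) =ᵐ[volume.restrict (Ioo a b)]
      fun ω => -inner ℝ (n ω) (e 2) * ‖weakDeriv a b n ω‖ ^ 2 + ‖cross (n ω) (e 2)‖ ^ 2 := by
    filter_upwards [hK.ae_unique hsum.toIsPrimitive hab.le, inner_weakDeriv_self_ae_eq_zero hab hn,
      ae_restrict_mem measurableSet_Ioo] with ω hω horth hωI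
    have e1 : inner ℝ (cross (weakDeriv a b n ω) (e 2)) (cross (n ω) (weakDeriv a b n ω)) =
        -inner ℝ (n ω) (e 2) * ‖weakDeriv a b n ω‖ ^ 2 := by
      rw [inner_cross_cross, real_inner_comm (n ω) (weakDeriv a b n ω), horth,
        real_inner_self_eq_norm_sq, real_inner_comm (n ω) (e 2)]
      ring
    have c0 : cross (n ω) 0 = 0 := map_zero (crossL (n ω))
    rw [c0, add_zero] at hω
    rw [← e1, hω, ← real_inner_self_eq_norm_sq]
    nth_rewrite 1 [hdec ω (Ioo_subset_Icc_self hωI)]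
    simp only [inner_add_left, real_inner_smul_left, inner_cross_self_left,
      inner_cross_self_right, columnTestIntegrand]
    ring
  have hint := Integrable.congr (i1.add i2) hae
  have hzero := integral_congr_ae hae
  rw [integral_add i1 i2, z1, z2, add_zero] at hzero
  have hnn : ∀ᵐ ω ∂volume.restrict (Ioo a b),
      0 ≤ -inner ℝ (n ω) (e 2) * ‖weakDeriv a b n ω‖ ^ 2 + ‖cross (n ω) (e 2)‖ ^ 2 := by
    filter_upwards [ae_restrict_mem measurableSet_Ioo] with ω hω
    have := neg_pos.2 (hneg ω (Ioo_subset_Icc_self hω))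
    positivity
  have hcross := eqOn_Icc_of_ae_eq hab (hK.continuousOn hab.le) (continuousOn_const (c := 0)) (by
    filter_upwards [(integral_eq_zero_iff_of_nonneg_ae hnn hint).1 hzero.symm,
      ae_restrict_mem measurableSet_Ioo] with ω h2 hω
    have h3 := neg_pos.2 (hneg ω (Ioo_subset_Icc_self hω))
    have h4 : 0 ≤ -inner ℝ (n ω) (e 2) * ‖weakDeriv a b n ω‖ ^ 2 := by positivity
    have h5 : 0 ≤ ‖cross (n ω) (e 2)‖ ^ 2 := by positivity
    simp only [Pi.zero_apply] at h2
    have h6 : ‖cross (n ω) (e 2)‖ ^ 2 = 0 := by linarith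
    exact norm_eq_zero.1 (pow_eq_zero_iff two_ne_zero |>.1 h6))
  exact fun ω hω => eq_neg_e_two_of_cross_eq_zero (hn.2 ω hω) (hcross hω) (hneg ω hω)

theorem norm_e (i : Fin 3) : ‖e i‖ = 1 := by simp [e]

/-- Close to the south pole, a state lies in the lower hemisphere and is nowhere orthogonal to
`R e₃`, uniformly in the rotations `R` that send `M_f` to `-e₃`. -/
theorem exists_pos_forall_inner_ne_zero (hab : a < b) {Mf : ℝ → E3} (hMf : MemH1 a b Mf)
    (hemi : ∀ ω ∈ Icc a b, inner ℝ (Mf ω) (e 2) ≠ 0) :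
    ∃ δ > 0, ∀ R : ℝ → Matrix (Fin 3) (Fin 3) ℝ, MemH1SO3 a b R →
      (∀ ω ∈ Icc a b, toOp (R ω) (Mf ω) = -e 2) → ∀ n : ℝ → E3, MemH1 a b n →
        h1norm a b (fun ω => n ω + e 2) < δ → ∀ ω ∈ Icc a b,
          inner ℝ (n ω) (e 2) < 0 ∧ inner ℝ (n ω) (toOp (R ω) (e 2)) ≠ 0 := by
  have hc : ContinuousOn (fun ω => |inner ℝ (Mf ω) (e 2)|) (Icc a b) :=
    (hMf.1.inner continuousOn_const).abs
  obtain ⟨ω₀, hω₀, hmin⟩ := isCompact_Icc.exists_isMinOn (nonempty_Icc.2 hab.le) hc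
  have hm : 0 < |inner ℝ (Mf ω₀) (e 2)| := abs_pos.2 (hemi ω₀ hω₀)
  have hK := sobolevConst_pos hab
  -- By the Sobolev embedding, `‖n + e₃‖` is everywhere smaller than `1` and than `min |⟨M_f, e₃⟩|`.
  refine ⟨min 1 |inner ℝ (Mf ω₀) (e 2)| / sobolevConst a b, by positivity,
    fun R hR hRM n hn hδ ω hω => ?_⟩
  have hsum := (hn.hasH1Deriv hab).add (HasH1Deriv.const (e 2)) hab.le
  have h1 := (hsum.toIsPrimitive.memH1 hab hsum.memLp).norm_le_h1norm hab hω
  rw [lt_div_iff₀ hK, mul_comm] at hδ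
  have h2 : ‖n ω + e 2‖ < min 1 |inner ℝ (Mf ω₀) (e 2)| := h1.trans_lt hδ
  have h3 : ‖n ω + e 2‖ < 1 := h2.trans_le (min_le_left _ _)
  have h4 : ‖n ω + e 2‖ < |inner ℝ (Mf ω) (e 2)| :=
    (h2.trans_le (min_le_right _ _)).trans_le (hmin hω)
  have hsplit : ∀ y : E3, inner ℝ (n ω) y = inner ℝ (n ω + e 2) y - inner ℝ (e 2) y := by
    intro y
    rw [inner_add_left]
    ring
  constructor
  · have h5 := real_inner_le_norm (n ω + e 2) (e 2)
    rw [norm_e, mul_one] at h5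
    rw [hsplit, real_inner_self_eq_norm_sq, norm_e]
    linarith
  · intro h0
    have h5 : ‖toOp (R ω) (e 2)‖ = 1 := by
      have := inner_toOp_toOp (hR.2 ω hω) (e 2) (e 2)
      rw [real_inner_self_eq_norm_sq, real_inner_self_eq_norm_sq, norm_e] at this
      exact (pow_left_inj₀ (norm_nonneg _) zero_le_one two_ne_zero).1 this
    have h6 : inner ℝ (e 2) (toOp (R ω) (e 2)) = -inner ℝ (Mf ω) (e 2) := by
      rw [← inner_toOp_toOp (hR.2 ω hω) (Mf ω), hRM ω hω, inner_neg_left, neg_neg]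
    have h7 := abs_real_inner_le_norm (n ω + e 2) (toOp (R ω) (e 2))
    rw [h5, mul_one] at h7
    rw [hsplit, h6, sub_neg_eq_add] at h0
    rw [eq_neg_of_add_eq_zero_left h0, abs_neg] at h7
    exact absurd h7 (not_le.2 h4)

end StationaryStates

end

end BlochEnsemble

theorem proposition3 (a b T : ℝ) (hab : a < b) (hT : 0 < T)
    (Mf : ℝ → E3) (hMf : MemH1Sphere a b Mf)
    (hemi : ∀ ω ∈ Icc a b, inner ℝ (Mf ω) (e 2) ≠ 0) (C : ℝ) :
    ∃ δ > 0, ∀ R : ℝ → Matrix (Fin 3) (Fin 3) ℝ, MemH1SO3 a b R →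
      (∀ ω ∈ Icc a b, toOp (R ω) (Mf ω) = -e 2) →
      h1norm a b (fun ω => toOp (R ω)) ≤ C * h1norm a b Mf →
      ∀ N₀ : ℝ → E3, MemH1Sphere a b N₀ → h1norm a b (fun ω => N₀ ω + e 2) < δ →
        ∀ N : ℝ → ℝ → E3, IsSolution a b T R N₀ N →
          ((∃ c : ℝ, ∀ t, 0 ≤ t → lyapunov a b (N t) = c) ↔ ∀ ω ∈ Icc a b, N₀ ω = -e 2) := by
  obtain ⟨δ, hδ, hδR⟩ := exists_pos_forall_inner_ne_zero hab hMf.1 hemi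
  refine ⟨δ, hδ, fun R hR hRM _ N₀ hN₀ hN₀δ N ⟨hN0, V, hNV, hV⟩ => ?_⟩
  have hL : ∀ t, 0 ≤ t → HasDerivWithinAt (fun s => lyapunov a b (N s))
      (-(H a b T R 0 t (N t) ^ 2 + H a b T R 1 t (N t) ^ 2)) (Ici 0) t := fun t ht =>
    hasDerivWithinAt_lyapunov_of_isSolution hab hR hNV hV ht
  constructor
  · rintro ⟨c, hc⟩
    have hH : ∀ t, 0 ≤ t → H a b T R 0 t (N t) = 0 ∧ H a b T R 1 t (N t) = 0 := by
      intro t ht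
      have h1 := (hasDerivWithinAt_const t (Ici 0) c).congr (fun s hs => hc s hs) (hc t ht)
      have h2 := (uniqueDiffOn_Ici (0 : ℝ) t ht).eq_deriv _ (hL t ht) h1
      constructor <;> nlinarith [sq_nonneg (H a b T R 0 t (N t)), sq_nonneg (H a b T R 1 t (N t))]
    have hconst : ∀ t, 0 ≤ t → EqOn N₀ (N t) (Icc a b) := by
      intro t ht ω hω
      rw [← hN0 hω]
      refine (eq_of_hasDerivWithinAt_zero (f := fun s => N s ω) (fun s hs => ?_) ht).symm
      refine (hNV.hasDerivWithinAt_apply hab hs hω).congr_deriv ?_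
      rw [hV s hs ω hω, u, u, (hH s hs).1, (hH s hs).2]
      simp
    -- The feedbacks depend on the state only through its values on `[a, b]`.
    have hHeq : ∀ (i : Fin 3) (t : ℝ), 0 ≤ t → H a b T R i t N₀ = H a b T R i t (N t) := by
      intro i t ht
      have hw := ((hN₀.1.hasH1Deriv hab).congr hab.le (hconst t ht) (ae_eq_refl _)).weakDeriv_ae_eq
        hab
      refine integral_congr_ae ?_
      filter_upwards [hw, ae_restrict_mem measurableSet_Ioo] with ω h1 hω
      rw [h1, hconst t ht (Ioo_subset_Icc_self hω)]
    exact eq_neg_e_two_of_feedback_eq_zero hab hT hR hN₀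
      (fun t ht => (hHeq 0 t ht.1).trans (hH t ht.1).1)
      (fun t ht => (hHeq 1 t ht.1).trans (hH t ht.1).2)
      (fun ω hω => (hδR R hR hRM N₀ hN₀.1 hN₀δ ω hω).1)
      (fun ω hω => (hδR R hR hRM N₀ hN₀.1 hN₀δ ω hω).2)
  · intro hN₀e
    have hanti : AntitoneOn (fun s => lyapunov a b (N s)) (Ici 0) := by
      refine antitoneOn_of_deriv_nonpos (convex_Ici 0)
        (fun t ht => (hL t ht).continuousWithinAt) (fun t ht => ?_) (fun t ht => ?_)
      all_goals rw [interior_Ici] at ht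
      all_goals have h1 := (hL t (le_of_lt ht)).hasDerivAt (Ici_mem_nhds ht)
      · exact h1.differentiableAt.differentiableWithinAt
      · rw [h1.deriv]
        exact neg_nonpos.2 (by positivity)
    refine ⟨0, fun t ht => le_antisymm ?_ ?_⟩
    · refine (hanti (mem_Ici.2 le_rfl) ht ht).trans (lyapunov_eq_zero hab fun ω hω => ?_).le
      rw [hN0 hω, hN₀e ω hω]
    · refine lyapunov_nonneg fun ω hω => ?_
      rw [norm_eq_of_isSolution hab hNV hV ht hω, hN0 hω, hN₀.2 ω hω]
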